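/- **Theorem 6.** An instance of the RegularGcc matrix constraint consists of an $r\times n$ matrix $(x_{i,j})$ of decision variables, each with a given finite domain $D_{i,j}\subseteq V$ in a common finite set $V$ of values, a (complete) deterministic finite automaton $\mathcal A_i$ over $V$ for each row $i$, and, for each column $j$ and each value $v\in V$, a lower bound $l_{j,v}$ and an upper bound $u_{j,v}$ in $\mathbb N$. An assignment of values to the variables is a solution if $x_{i,j}\in D_{i,j}$ for all $i,j$, each row $x_{i,1}\cdots x_{i,n}$ is a word accepted by $\mathcal A_i$, and for each column $j$ and each value $v$ the number of rows $i$ with $x_{i,j}=v$ is at least $l_{j,v}$ and at most $u_{j,v}$. Enforcing domain consistency means computing the subdomains $D'_{i,j}\subseteq D_{i,j}$ that contain all solutions and for which every $v\in D'_{i,j}$ is the value of $x_{i,j}$ in some solution within the domains $D'$. Enforcing domain consistency on RegularGcc is fixed-parameter tractable in $k=r\log Q$, where $Q$ is the largest number of states of a row automaton: there are an algorithm, a computable function $f:\mathbb N\to\mathbb N$ and a polynomial $p$ such that on every instance $I$ the algorithm computes the domain-consistent subdomains of $I$ in time at most $f(\lceil r\log_2 Q\rceil)\cdot p(|I|)$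 (with the convention that $r\log_2 Q=0$ if $r=0$), where $|I|$ is the bit length of the instance (automata given by their transition tables, domains by bit vectors, bounds in binary). -/

import Mathlib

/-! ## Machine model: random access machine, uniform cost -/

namespace Ram

/-- State of a random access machine: registers, random access memory, output tape. -/
structure State where
  reg : ℕ → ℕ
  mem : ℕ → ℕ
  out : List ℕ

/-- Elementary instructions. The only arithmetic operations are addition, (truncated) subtraction
and halving, so that counting each of them as one step is, up to a polynomial, the same as time on
a Turing machine. -/
inductive Op where
  | const (a c : ℕ)
  | copy (a b : ℕ)
  | add (a b c : ℕ)
  | sub (a b c : ℕ)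
  | half (a b : ℕ)
  | load (a b : ℕ)
  | store (a b : ℕ)
  | write (a : ℕ)

/-- Effect of an elementary instruction: `load a b` puts into register `a` the memory cell whose
address is in register `b`; `store a b` puts register `b` into the memory cell whose address is in
register `a`; `write a` appends register `a` to the output tape. -/
def Op.apply : Op → State → State
  | .const a c, s => { s with reg := Function.update s.reg a c }
  | .copy a b, s => { s with reg := Function.update s.reg a (s.reg b) }
  | .add a b c, s => { s with reg := Function.update s.reg a (s.reg b + s.reg c) }
  | .sub a b c, s => { s with reg := Function.update s.reg a (s.reg b - s.reg c) }
  | .half a b, s => { s with reg := Function.update s.reg a (s.reg b / 2) }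
  | .load a b, s => { s with reg := Function.update s.reg a (s.mem (s.reg b)) }
  | .store a b, s => { s with mem := Function.update s.mem (s.reg a) (s.reg b) }
  | .write a, s => { s with out := s.out ++ [s.reg a] }

/-- Programs: sequences, branching on `reg a ≠ 0`, and loops running while `reg a ≠ 0`. -/
inductive Prog where
  | op (o : Op)
  | seq (p q : Prog)
  | branch (a : ℕ) (p q : Prog)
  | loop (a : ℕ) (p : Prog)

/-- `Exec p s t s'`: started in state `s`, the program `p` halts in state `s'` after exactly `t`
steps; every elementary instruction and every test of a register is one step. -/
inductive Exec : Prog → State → ℕ → State → Prop where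
  | op (o : Op) (s : State) : Exec (.op o) s 1 (o.apply s)
  | seq {p q : Prog} {s s' s'' : State} {t t' : ℕ} :
      Exec p s t s' → Exec q s' t' s'' → Exec (.seq p q) s (t + t') s''
  | branch_pos {a : ℕ} {p q : Prog} {s s' : State} {t : ℕ} :
      s.reg a ≠ 0 → Exec p s t s' → Exec (.branch a p q) s (t + 1) s'
  | branch_zero {a : ℕ} {p q : Prog} {s s' : State} {t : ℕ} :
      s.reg a = 0 → Exec q s t s' → Exec (.branch a p q) s (t + 1) s'
  | loop_pos {a : ℕ} {p : Prog} {s s' s'' : State} {t t' : ℕ} :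
      s.reg a ≠ 0 → Exec p s t s' → Exec (.loop a p) s' t' s'' →
      Exec (.loop a p) s (t + t' + 1) s''
  | loop_zero {a : ℕ} {p : Prog} {s : State} :
      s.reg a = 0 → Exec (.loop a p) s 1 s

/-- Initial state on input `x`: the input is in the memory cells `0, …, x.length - 1`, its length
is in register `0`; everything else is zero and the output tape is empty. -/
def init (x : List ℕ) : State where
  reg := Function.update (fun _ => 0) 0 x.length
  mem := fun i => x.getD i 0
  out := []

/-- On input `x` the program `p` halts after exactly `t` steps with output `y`. -/
def Outputs (p : Prog) (x : List ℕ) (t : ℕ) (y : List ℕ) : Prop :=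
  ∃ s : State, Exec p (init x) t s ∧ s.out = y

end Ram

/-- Bit length of an input: every number is written in binary, followed by a separator. -/
def inputSize (x : List ℕ) : ℕ :=
  (x.map fun a => Nat.size a + 1).sum

/-- Fixed-parameter tractability of a search problem: instances `I : ι` are presented as `enc I`,
`Answer I y` says that `y` is a correct output, and `κ` is the parameter. A single program answers
every instance within `f (κ I) * poly(size of I)` steps, where `f` is computable. -/
def FixedParameterTractable {ι : Type} (enc : ι → List ℕ) (Answer : ι → List ℕ → Prop)
    (κ : ι → ℕ) : Prop :=
  ∃ (P : Ram.Prog) (f : ℕ → ℕ) (p : Polynomial ℕ), Computable f ∧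
    ∀ I : ι, ∃ (t : ℕ) (y : List ℕ), Ram.Outputs P (enc I) t y ∧ Answer I y ∧
      t ≤ f (κ I) * p.eval (inputSize (enc I))

/-! ## The constraint -/

/-- An instance of the RegularGcc matrix constraint: a `rows × cols` matrix of decision variables
with values in `Fin vals`, a finite domain for each of them, a complete DFA for each row, and for
each column and each value a lower and an upper bound on the number of occurrences. -/
structure RegularGcc where
  rows : ℕ
  cols : ℕ
  vals : ℕ
  states : Fin rows → ℕ
  aut : (i : Fin rows) → DFA (Fin vals) (Fin (states i))
  lower : Fin cols → Fin vals → ℕ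
  upper : Fin cols → Fin vals → ℕ
  dom : Fin rows → Fin cols → Finset (Fin vals)

namespace RegularGcc

/-- Assignments of values to the decision variables. -/
abbrev Assignment (I : RegularGcc) : Type := Fin I.rows → Fin I.cols → Fin I.vals

/-- A domain for each decision variable. -/
abbrev Domains (I : RegularGcc) : Type := Fin I.rows → Fin I.cols → Finset (Fin I.vals)

/-- The constraint proper: every row is a word accepted by its automaton (Regular), and in every
column the number of occurrences of each value is within its bounds (Gcc). -/
def Holds (I : RegularGcc) (M : I.Assignment) : Prop :=
  (∀ i, List.ofFn (M i) ∈ (I.aut i).accepts) ∧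
  ∀ j v, I.lower j v ≤ (Finset.univ.filter fun i => M i j = v).card ∧
    (Finset.univ.filter fun i => M i j = v).card ≤ I.upper j v

/-- `M` is a solution of the constraint within the domains `D`. -/
def IsSolution (I : RegularGcc) (D : I.Domains) (M : I.Assignment) : Prop :=
  (∀ i j, M i j ∈ D i j) ∧ I.Holds M

/-- The constraint is domain consistent on the domains `D`: each value in the domain of each
variable is taken by that variable in some solution. -/
def DomainConsistent (I : RegularGcc) (D : I.Domains) : Prop :=
  ∀ i j, ∀ v ∈ D i j, ∃ M, I.IsSolution D M ∧ M i j = v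

/-- `D` is the result of enforcing domain consistency on `I`: the domains are reduced to a domain
consistent state without losing a solution. -/
def EnforcesDC (I : RegularGcc) (D : I.Domains) : Prop :=
  (∀ i j, D i j ⊆ I.dom i j) ∧ I.DomainConsistent D ∧
    ∀ M, I.IsSolution I.dom M → I.IsSolution D M

/-- Domains as a list of `rows * cols * vals` bits, row by row. -/
def encodeDomains (I : RegularGcc) (D : I.Domains) : List ℕ :=
  (List.finRange I.rows).flatMap fun i => (List.finRange I.cols).flatMap fun j =>
    (List.finRange I.vals).map fun v => if v ∈ D i j then 1 else 0

open Classical in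
/-- A DFA as a list of numbers: number of states, start state, one acceptance bit for each state,
and the transition table, state by state. -/
noncomputable def encodeDFA {d q : ℕ} (A : DFA (Fin d) (Fin q)) : List ℕ :=
  [q, (A.start : ℕ)] ++ ((List.finRange q).map fun s => if s ∈ A.accept then 1 else 0) ++
    (List.finRange q).flatMap fun s => (List.finRange d).map fun v => (A.step s v : ℕ)

/-- Cardinality bounds as a list of numbers, column by column. -/
def encodeBounds {n d : ℕ} (b : Fin n → Fin d → ℕ) : List ℕ :=
  (List.finRange n).flatMap fun j => (List.finRange d).map fun v => b j v

/-- An instance as a list of numbers. -/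
noncomputable def encode (I : RegularGcc) : List ℕ :=
  [I.rows, I.cols, I.vals] ++ ((List.finRange I.rows).flatMap fun i => encodeDFA (I.aut i)) ++
    I.encodeDomains I.dom ++ encodeBounds I.lower ++ encodeBounds I.upper

/-- The largest number of states of a row automaton. -/
def maxStates (I : RegularGcc) : ℕ := Finset.univ.sup I.states

/-- The parameter `r * log₂ Q`, rounded up to an integer. -/
noncomputable def parameter (I : RegularGcc) : ℕ :=
  ⌈(I.rows : ℝ) * Real.logb 2 (I.maxStates : ℝ)⌉₊

end RegularGcc

/-! A tuple of states, one for each row automaton, is a number below `Q ^ r = 2 ^ (r log₂ Q)`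
written in base `Q`. Columns of an assignment interact only through such tuples, so a dynamic
program that keeps, column by column, the set of reachable codes (`Reach`) decides solvability: some
reachable code must be accepting (`exists_isSolution_iff`). The values taken in solutions form the
domain consistent state (`enforcesDC_consistentDomains`), and each value is tested by forcing it
(`isSolution_forced_iff`).

Whether a column can lead from one code to another is a pure cardinality problem: every row has a
set of permitted values and every value has occurrence bounds. With `r` slots per value and dummy
persons besides the rows it becomes a perfect matching problem (`hasMatching_iff_gccSolvable`).
Matching is decided by an auction with unit price increments (`Ram.auction_spec`): prices are
capped, so it soon stops, and a bidder without affordable object exhibits a violation of Hall's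
condition (`AuctionInv.not_hasMatching`). An auction needs only bounded minimum searches and single
cell updates.

The machine program arises from closure properties: expressions (`Comp`), predicates (`CompP`) and
array transformations (`CompT`) built from bounded sums, quantifiers and iterations take time
polynomial in register `0`, the common bound of all loops. Correctness thus concerns functions on
eight arrays: `0` input, `1` positions of the automata, `2` and `3` current and next codes, `4`
prices, `5` owners, `6` answers, `7` powers of `Q`. The main part runs with loop bound `Q ^ r * L ^
4`, where `L` is the length of the encoding, and `Polynomial.eval_mul_le` separates the parameter
from the input size. -/

namespace Ram

/-! ### Time-bounded Hoare rules for the machine -/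

/-- `Runs P s K R`: started in `s`, the program `P` halts within `K` steps in a state satisfying `R`. -/
def Runs (P : Prog) (s : State) (K : ℕ) (R : State → Prop) : Prop :=
  ∃ t s', Exec P s t s' ∧ t ≤ K ∧ R s'

theorem Runs.mono {P : Prog} {s : State} {K L : ℕ} {R R' : State → Prop}
    (h : Runs P s K R) (hK : K ≤ L) (hR : ∀ s', R s' → R' s') : Runs P s L R' := by
  obtain ⟨t, s', he, ht, hr⟩ := h
  exact ⟨t, s', he, ht.trans hK, hR _ hr⟩

theorem Runs.op {o : Op} {s : State} {R : State → Prop} (h : R (o.apply s)) :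
    Runs (.op o) s 1 R :=
  ⟨1, _, .op o s, le_rfl, h⟩

theorem Runs.seq {P Q : Prog} {s : State} {K L : ℕ} {R : State → Prop}
    (h : Runs P s K fun s' => Runs Q s' L R) : Runs (.seq P Q) s (K + L) R := by
  obtain ⟨t, s', he, ht, t', s'', he', ht', hr⟩ := h
  exact ⟨t + t', s'', .seq he he', by omega, hr⟩

/-- A sequence of elementary instructions followed by a program. -/
def ops : List Op → Prog → Prog
  | [], P => P
  | o :: l, P => .seq (.op o) (ops l P)

theorem Runs.ops {l : List Op} {P : Prog} {s : State} {K : ℕ} {R : State → Prop}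
    (h : Runs P (l.foldl (fun s o => o.apply s) s) K R) : Runs (ops l P) s (l.length + K) R := by
  induction l generalizing s with
  | nil => simpa [Ram.ops] using h
  | cons o l ih =>
    have h2 : Runs (.seq (.op o) (Ram.ops l P)) s (1 + (l.length + K)) R := .seq (.op (ih h))
    refine h2.mono (by simp; omega) fun _ h => h

theorem Runs.branch {a : ℕ} {P Q : Prog} {s : State} {K : ℕ} {R : State → Prop}
    (h : s.reg a ≠ 0 → Runs P s K R) (h' : s.reg a = 0 → Runs Q s K R) :
    Runs (.branch a P Q) s (K + 1) R := by
  by_cases ha : s.reg a = 0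
  · obtain ⟨t, s', he, ht, hr⟩ := h' ha
    exact ⟨t + 1, s', .branch_zero ha he, by omega, hr⟩
  · obtain ⟨t, s', he, ht, hr⟩ := h ha
    exact ⟨t + 1, s', .branch_pos ha he, by omega, hr⟩

/-- Every loop of the program counts a register down, so the number of rounds is fixed on entry.
Each round costs its body and one test; the last summand is the failing test at the end. -/
theorem Runs.loop {c : ℕ} {P : Prog} {N K : ℕ} (Inv : ℕ → State → Prop)
    (h : ∀ i s, i < N → Inv i s → s.reg c = N - i →
      Runs P s K fun s' => Inv (i + 1) s' ∧ s'.reg c = N - (i + 1))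
    {s : State} (h0 : Inv 0 s) (hc : s.reg c = N) :
    Runs (.loop c P) s (N * (K + 1) + 1) (Inv N) := by
  suffices H : ∀ k i s, i + k = N → Inv i s → s.reg c = N - i →
      Runs (.loop c P) s (k * (K + 1) + 1) (Inv N) from H N 0 s (by omega) h0 (by omega)
  intro k
  induction k with
  | zero =>
    intro i s hi hs hc
    obtain rfl : i = N := by omega
    exact ⟨1, s, .loop_zero (by omega), by omega, hs⟩
  | succ k ih =>
    intro i s hi hs hc
    obtain ⟨t, s', he, ht, hs', hc'⟩ := h i s (by omega) hs hc
    obtain ⟨t', s'', he', ht', hr⟩ := ih (i + 1) s' (by omega) hs' hc'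
    refine ⟨t + t' + 1, s'', .loop_pos (by omega) he he', ?_, hr⟩
    rw [Nat.succ_mul]; omega

/-! ### Arrays in memory -/

/-- Eight unbounded arrays. -/
abbrev Arr := Fin 8 → ℕ → ℕ

/-- Assign `x` to the cell `i` of the array `k`. -/
def setCell (A : Arr) (k : Fin 8) (i x : ℕ) : Arr :=
  Function.update A k (Function.update (A k) i x)

/-- The memory in which the arrays are interleaved. -/
def flat (A : Arr) : ℕ → ℕ := fun m => A ⟨m % 8, Nat.mod_lt _ (by norm_num)⟩ (m / 8)

theorem flat_apply (A : Arr) (k : Fin 8) (i : ℕ) : flat A (8 * i + k) = A k i := by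
  have h1 : (8 * i + k) % 8 = k := by omega
  have h2 : (8 * i + k) / 8 = i := by omega
  simp [flat, h1, h2]

theorem flat_setCell (A : Arr) (k : Fin 8) (i x : ℕ) :
    flat (setCell A k i x) = Function.update (flat A) (8 * i + k) x := by
  funext m
  by_cases hm : m = 8 * i + k
  · subst hm
    rw [flat_apply]; simp [setCell]
  · rw [Function.update_of_ne hm]
    unfold flat setCell
    by_cases hk : (⟨m % 8, Nat.mod_lt _ (by norm_num)⟩ : Fin 8) = k
    · have : m / 8 ≠ i := by
        rintro rfl
        apply hm
        have := congrArg Fin.val hk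
        simp at this
        omega
      rw [hk]
      simp [this]
    · rw [Function.update_of_ne hk]

/-! ### Expressions -/

/-- The expression `F`, in terms of registers `0, …, n` and of the arrays, can be evaluated in time
polynomial in register `0`. -/
def Comp (n : ℕ) (F : (ℕ → ℕ) → Arr → ℕ) : Prop :=
  (∀ v v', (∀ i ≤ n, v i = v' i) → ∀ A, F v A = F v' A) ∧
  ∀ m ≥ n, ∃ (P : Prog) (p : Polynomial ℕ), ∀ s A, s.mem = flat A →
    Runs P s (p.eval (s.reg 0)) fun s' => s'.mem = s.mem ∧ s'.out = s.out ∧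
      (∀ i ≤ m, s'.reg i = s.reg i) ∧ s'.reg (m + 1) = F s.reg A

variable {n m : ℕ} {f g c : (ℕ → ℕ) → Arr → ℕ}

theorem Comp.mono (h : Comp n f) (hm : n ≤ m) : Comp m f :=
  ⟨fun v v' hv => h.1 v v' fun i hi => hv i (hi.trans hm), fun m' hm' => h.2 m' (hm.trans hm')⟩

theorem Comp.const (a : ℕ) : Comp n fun _ _ => a := by
  refine ⟨fun _ _ _ _ => rfl, fun m _ => ⟨.op (.const (m + 1) a), 1, fun s A _ => ?_⟩⟩
  rw [Polynomial.eval_one]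
  exact .op ⟨rfl, rfl, fun i hi => Function.update_of_ne (by omega) _ _, Function.update_self ..⟩

theorem Comp.var {i : ℕ} (hi : i ≤ n) : Comp n fun v _ => v i := by
  refine ⟨fun v v' h _ => h i hi, fun m _ => ⟨.op (.copy (m + 1) i), 1, fun s A _ => ?_⟩⟩
  rw [Polynomial.eval_one]
  exact .op ⟨rfl, rfl, fun i hi => Function.update_of_ne (by omega) _ _, Function.update_self ..⟩

/-- The second operand is evaluated with `m + 1` in place of `m`, so that the value of the first one
survives. For such compositions `Comp` asks for a program for every `m ≥ n`, with the registers
above `m` as scratch space. -/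
theorem Comp.binop (φ : ℕ → ℕ → ℕ) (o : ℕ → Op)
    (ho : ∀ m s, (o m).apply s =
      { s with reg := Function.update s.reg (m + 1) (φ (s.reg (m + 1)) (s.reg (m + 2))) })
    (hf : Comp n f) (hg : Comp n g) : Comp n fun v A => φ (f v A) (g v A) := by
  refine ⟨fun v v' h A => by simp only [hf.1 v v' h, hg.1 v v' h], fun m hm => ?_⟩
  obtain ⟨P, p, hP⟩ := hf.2 m hm
  obtain ⟨Q, q, hQ⟩ := hg.2 (m + 1) (by omega)
  refine ⟨.seq P (.seq Q (.op (o m))), p + (q + 1), fun s A hs => ?_⟩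
  simp only [Polynomial.eval_add, Polynomial.eval_one]
  refine .seq ((hP s A hs).mono le_rfl fun s1 ⟨h1, h2, h3, h4⟩ => ?_)
  have := hQ s1 A (h1.trans hs)
  rw [h3 0 (by omega)] at this
  refine .seq (this.mono le_rfl fun s2 ⟨k1, k2, k3, k4⟩ => .op ?_)
  rw [ho]
  refine ⟨k1.trans h1, k2.trans h2, fun i hi => ?_, ?_⟩
  · simp only
    rw [Function.update_of_ne (by omega), k3 i (by omega), h3 i hi]
  · simp only [Function.update_self]
    rw [k4, k3 _ le_rfl, h4, hg.1 s1.reg s.reg (fun i hi => h3 i (by omega)) A]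

theorem Comp.add (hf : Comp n f) (hg : Comp n g) : Comp n fun v A => f v A + g v A :=
  .binop (· + ·) (fun m => .add (m + 1) (m + 1) (m + 2)) (fun _ _ => rfl) hf hg

theorem Comp.sub (hf : Comp n f) (hg : Comp n g) : Comp n fun v A => f v A - g v A :=
  .binop (· - ·) (fun m => .sub (m + 1) (m + 1) (m + 2)) (fun _ _ => rfl) hf hg

/-- Three doublings multiply the index by 8, the stride of the interleaved arrays. -/
theorem Comp.read (k : Fin 8) (hf : Comp n f) : Comp n fun v A => A k (f v A) := by
  refine ⟨fun v v' h A => by simp only [hf.1 v v' h], fun m hm => ?_⟩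
  obtain ⟨P, p, hP⟩ := hf.2 m hm
  refine ⟨.seq P (ops [.add (m + 1) (m + 1) (m + 1), .add (m + 1) (m + 1) (m + 1),
    .add (m + 1) (m + 1) (m + 1), .const (m + 2) k, .add (m + 1) (m + 1) (m + 2)]
    (.op (.load (m + 1) (m + 1)))), p + 6, fun s A hs => ?_⟩
  have : (p + 6).eval (s.reg 0) = p.eval (s.reg 0) + (5 + 1) := by
    simp
  rw [this]
  refine .seq ((hP s A hs).mono le_rfl fun s1 ⟨h1, h2, h3, h4⟩ => .ops (.op ?_))
  refine ⟨h1, h2, fun i hi => ?_, ?_⟩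
  · have e1 : i ≠ m + 1 := by omega
    have e2 : i ≠ m + 2 := by omega
    simp [Op.apply, e1, e2, h3 i hi]
  · change _ = A k (f s.reg A)
    rw [← flat_apply A k]
    simp only [List.foldl, Op.apply, Function.update_apply, h4, h1, hs]
    simp
    congr 1
    omega

theorem Comp.ite_ne (hc : Comp n c) (hf : Comp n f) (hg : Comp n g) :
    Comp n fun v A => if c v A ≠ 0 then f v A else g v A := by
  refine ⟨fun v v' h A => by simp only [hf.1 v v' h, hg.1 v v' h, hc.1 v v' h], fun m hm => ?_⟩
  obtain ⟨C, c', hC⟩ := hc.2 m hm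
  obtain ⟨P, p, hP⟩ := hf.2 m hm
  obtain ⟨Q, q, hQ⟩ := hg.2 m hm
  refine ⟨.seq C (.branch (m + 1) P Q), c' + (p + q + 1), fun s A hs => ?_⟩
  simp only [Polynomial.eval_add, Polynomial.eval_one]
  refine .seq ((hC s A hs).mono le_rfl fun s1 ⟨h1, h2, h3, h4⟩ => .branch (fun h => ?_) fun h => ?_)
  · refine (hP s1 A (h1.trans hs)).mono (by rw [h3 0 (by omega)]; omega)
      fun s2 ⟨k1, k2, k3, k4⟩ => ⟨k1.trans h1, k2.trans h2, fun i hi => (k3 i hi).trans (h3 i hi), ?_⟩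
    rw [if_pos (by rwa [← h4]), k4, hf.1 _ _ (fun i hi => h3 i (by omega)) A]
  · refine (hQ s1 A (h1.trans hs)).mono (by rw [h3 0 (by omega)]; omega)
      fun s2 ⟨k1, k2, k3, k4⟩ => ⟨k1.trans h1, k2.trans h2, fun i hi => (k3 i hi).trans (h3 i hi), ?_⟩
    rw [if_neg (by rw [← h4, h]; simp), k4, hg.1 _ _ (fun i hi => h3 i (by omega)) A]

/-- A bounded sum; the body may use the summation index like any variable. -/
theorem Comp.sum {H : (ℕ → ℕ) → Arr → ℕ → ℕ}
    (h : ∀ m ≥ n, ∀ y : (ℕ → ℕ) → ℕ, Comp m (fun v _ => y v) → Comp m fun v A => H v A (y v)) :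
    Comp n fun v A => ∑ j ∈ Finset.range (v 0), H v A j := by
  -- A constant is an admissible `y`, so the body depends on the registers `0, …, n` only.
  have hind : ∀ v v', (∀ i ≤ n, v i = v' i) → ∀ A j, H v A j = H v' A j := fun v v' hv A j =>
    (h n le_rfl (fun _ => j) (.const j)).1 v v' hv A
  refine ⟨fun v v' hv A => ?_, fun m hm => ?_⟩
  · simp only [hv 0 (by omega)]
    exact Finset.sum_congr rfl fun j _ => hind v v' hv A j
  obtain ⟨P, p, hP⟩ := (h (m + 3) (by omega) (fun v => v (m + 3)) (.var le_rfl)).2 (m + 3) le_rfl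
  -- Register `m + 1` accumulates the sum, `m + 2` counts down from the bound, `m + 3` is the
  -- summation index (bound minus counter) and `m + 4` receives the value of the body.
  refine ⟨ops [.const (m + 1) 0, .copy (m + 2) 0] (.loop (m + 2)
    (ops [.sub (m + 3) 0 (m + 2)] (.seq P (ops [.add (m + 1) (m + 1) (m + 4), .const (m + 4) 1]
      (.op (.sub (m + 2) (m + 2) (m + 4))))))),
    2 + (Polynomial.X * ((1 + (p + 3)) + 1) + 1), fun s A hs => ?_⟩
  set B := s.reg 0 with hB
  have hev : (2 + (Polynomial.X * ((1 + (p + 3)) + 1) + 1)).eval B =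
      2 + (B * ((1 + (p.eval B + 3)) + 1) + 1) := by simp
  rw [hev]
  refine Runs.ops (l := [_, _]) ((Runs.loop (fun j s' => s'.mem = s.mem ∧ s'.out = s.out ∧
      (∀ i ≤ m, s'.reg i = s.reg i) ∧ s'.reg (m + 1) = ∑ j ∈ Finset.range j, H s.reg A j)
      ?_ ?_ ?_).mono le_rfl fun s' h => h)
  · rintro i s1 hi ⟨h1, h2, h3, h4⟩ hc
    refine Runs.ops (l := [_]) (.seq ?_)
    have := hP (Op.apply (.sub (m + 3) 0 (m + 2)) s1) A (h1.trans hs)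
    have h0 : (Op.apply (.sub (m + 3) 0 (m + 2)) s1).reg 0 = B := by
      simp [Op.apply, h3, hB]
    rw [h0] at this
    refine this.mono le_rfl fun s2 ⟨k1, k2, k3, k4⟩ => Runs.ops (l := [_, _]) (.op ?_)
    have hreg : ∀ i ≤ m + 2, s2.reg i = s1.reg i := fun i hi => by
      rw [k3 i (by omega)]
      exact Function.update_of_ne (by omega) _ _
    refine ⟨⟨k1.trans h1, k2.trans h2, fun i hi => ?_, ?_⟩, ?_⟩
    · have e1 : i ≠ m + 1 := by omega
      have e2 : i ≠ m + 2 := by omega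
      have e3 : i ≠ m + 4 := by omega
      simp [Op.apply, e1, e2, e3, hreg i (by omega), h3 i hi]
    · simp only [List.foldl, Op.apply, Function.update_apply]
      simp
      rw [hreg _ (by omega), h4, Finset.sum_range_succ, k4]
      congr 1
      have e : (Op.apply (.sub (m + 3) 0 (m + 2)) s1).reg (m + 3) = i := by
        simp [Op.apply, h3, hc]; omega
      simp only [e]
      refine hind _ _ (fun j hj => ?_) A i
      rw [← h3 j (by omega)]
      exact Function.update_of_ne (by omega) _ _
    · simp [Op.apply, hreg, hc]
      omega
  · refine ⟨rfl, rfl, fun i hi => ?_, ?_⟩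
    · have e1 : i ≠ m + 1 := by omega
      have e2 : i ≠ m + 2 := by omega
      simp [Op.apply, e1, e2]
    · simp [Op.apply]
  · simp [Op.apply, hB]

/-! ### Predicates -/

open Classical in
/-- The predicate `p` can be decided in time polynomial in register `0`. -/
def CompP (n : ℕ) (p : (ℕ → ℕ) → Arr → Prop) : Prop :=
  Comp n fun v A => if p v A then 1 else 0

variable {p q : (ℕ → ℕ) → Arr → Prop}

theorem Comp.of_eq (hf : Comp n f) (h : ∀ v A, f v A = g v A) : Comp n g := by
  have : f = g := by funext v A; exact h v A
  exact this ▸ hf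

theorem CompP.of_iff (hp : CompP n p) (h : ∀ v A, p v A ↔ q v A) : CompP n q := by
  have : p = q := by funext v A; exact propext (h v A)
  exact this ▸ hp

theorem CompP.ne_zero (hf : Comp n f) : CompP n fun v A => f v A ≠ 0 := by
  refine (hf.ite_ne (.const 1) (.const 0)).of_eq fun v A => ?_
  by_cases h : f v A = 0 <;> simp [h]

theorem Comp.ite [∀ v A, Decidable (p v A)] (hp : CompP n p) (hf : Comp n f) (hg : Comp n g) :
    Comp n fun v A => if p v A then f v A else g v A := by
  refine (Comp.ite_ne hp hf hg).of_eq fun v A => ?_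
  by_cases h : p v A <;> simp [h]

theorem CompP.not (hp : CompP n p) : CompP n fun v A => ¬ p v A := by
  refine (Comp.ite_ne hp (.const 0) (.const 1)).of_eq fun v A => ?_
  by_cases h : p v A <;> simp [h]

theorem CompP.and (hp : CompP n p) (hq : CompP n q) : CompP n fun v A => p v A ∧ q v A := by
  refine (Comp.ite_ne hp hq (.const 0)).of_eq fun v A => ?_
  by_cases h : p v A <;> by_cases h' : q v A <;> simp [h, h']

theorem CompP.or (hp : CompP n p) (hq : CompP n q) : CompP n fun v A => p v A ∨ q v A := by
  refine (Comp.ite_ne hp (.const 1) hq).of_eq fun v A => ?_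
  by_cases h : p v A <;> by_cases h' : q v A <;> simp [h, h']

theorem CompP.imp (hp : CompP n p) (hq : CompP n q) : CompP n fun v A => p v A → q v A :=
  (hp.not.or hq).of_iff fun _ _ => imp_iff_not_or.symm

theorem CompP.le (hf : Comp n f) (hg : Comp n g) : CompP n fun v A => f v A ≤ g v A :=
  (CompP.ne_zero (hf.sub hg)).not.of_iff fun v A => by rw [not_not, Nat.sub_eq_zero_iff_le]

theorem CompP.lt (hf : Comp n f) (hg : Comp n g) : CompP n fun v A => f v A < g v A :=
  (CompP.le hg hf).not.of_iff fun _ _ => not_le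

theorem CompP.eq (hf : Comp n f) (hg : Comp n g) : CompP n fun v A => f v A = g v A :=
  ((CompP.le hf hg).and (CompP.le hg hf)).of_iff fun _ _ => le_antisymm_iff.symm

/-- Bounded existential quantification. -/
theorem CompP.ex {H : (ℕ → ℕ) → Arr → ℕ → Prop}
    (h : ∀ m ≥ n, ∀ y : (ℕ → ℕ) → ℕ, Comp m (fun v _ => y v) → CompP m fun v A => H v A (y v)) :
    CompP n fun v A => ∃ j < v 0, H v A j := by
  classical
  refine (CompP.ne_zero (Comp.sum (H := fun v A j => if H v A j then 1 else 0) ?_)).of_iff ?_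
  · intro m hm y hy
    exact (Comp.ite (h m hm y hy) (.const 1) (.const 0))
  · intro v A
    simp

/-- Bounded universal quantification. -/
theorem CompP.all {H : (ℕ → ℕ) → Arr → ℕ → Prop}
    (h : ∀ m ≥ n, ∀ y : (ℕ → ℕ) → ℕ, Comp m (fun v _ => y v) → CompP m fun v A => H v A (y v)) :
    CompP n fun v A => ∀ j < v 0, H v A j :=
  (CompP.ex (H := fun v A j => ¬ H v A j) fun m hm y hy => (h m hm y hy).not).not.of_iff fun v A => by simp

open Classical in
/-- The least number below `B` with property `p`, or `B` if there is none. -/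
noncomputable def find (B : ℕ) (p : ℕ → Prop) : ℕ :=
  ∑ j ∈ Finset.range B, if ∀ i < B, i ≤ j → ¬ p i then 1 else 0

/-- The summands of `find` are 1 exactly before the first witness, so the sum counts up to it.
Searching is thereby a bounded sum and needs no program of its own. -/
theorem find_spec {B : ℕ} {p : ℕ → Prop} (h : ∃ j < B, p j) : find B p < B ∧ p (find B p) := by
  classical
  obtain ⟨hB, hp⟩ := Nat.find_spec h
  suffices find B p = Nat.find h by rw [this]; exact ⟨hB, hp⟩
  have : Finset.filter (fun j => ∀ i < B, i ≤ j → ¬ p i) (Finset.range B) =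
      Finset.range (Nat.find h) := by
    ext j
    simp only [Finset.mem_filter, Finset.mem_range]
    constructor
    · rintro ⟨h1, h2⟩
      by_contra h3
      exact h2 _ hB (not_lt.1 h3) hp
    · intro hj
      refine ⟨hj.trans hB, fun i hi hij hpi => ?_⟩
      exact Nat.find_min h (hij.trans_lt hj) ⟨hi, hpi⟩
  rw [find, ← Finset.sum_filter, this]
  simp

theorem find_le {B j : ℕ} {p : ℕ → Prop} (hj : j < B) (hp : p j) : find B p ≤ j := by
  classical
  rw [find, ← Finset.sum_filter, Finset.sum_const, smul_eq_mul, mul_one]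
  conv_rhs => rw [← Finset.card_range j]
  refine Finset.card_le_card fun k hk => ?_
  rw [Finset.mem_filter] at hk
  by_contra h
  exact hk.2 j hj (by simpa using h) hp

theorem find_eq {B : ℕ} {p : ℕ → Prop} (h : ¬ ∃ j < B, p j) : find B p = B := by
  rw [find, Finset.sum_congr rfl (g := fun _ => 1)]
  · simp
  · intro j _
    rw [if_pos fun i hi _ hpi => h ⟨i, hi, hpi⟩]

theorem Comp.find {H : (ℕ → ℕ) → Arr → ℕ → Prop}
    (h : ∀ m ≥ n, ∀ y : (ℕ → ℕ) → ℕ, Comp m (fun v _ => y v) → CompP m fun v A => H v A (y v)) :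
    Comp n fun v A => find (v 0) (H v A) := by
  unfold Ram.find
  classical
  exact Comp.sum (H := fun v A j => if ∀ i < v 0, i ≤ j → ¬ H v A i then 1 else 0)
    fun _ hm _ hy => Comp.ite (CompP.all fun m' hm' y' hy' =>
      .imp (.le hy' (hy.mono hm')) (h m' (hm.trans hm') y' hy').not) (.const 1) (.const 0)

/-- The product `x * y` if `y ≤ B`. -/
def mulB (B x y : ℕ) : ℕ := x * min y B

theorem mulB_eq {B x y : ℕ} (h : y ≤ B) : mulB B x y = x * y := by
  rw [mulB, min_eq_left h]

/-- Multiplication is repeated addition. Only the second factor is truncated; the first one may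
exceed the loop bound. -/
theorem Comp.mul (hf : Comp n f) (hg : Comp n g) : Comp n fun v A => mulB (v 0) (f v A) (g v A) := by
  refine (Comp.sum (H := fun v A j => if j < g v A then f v A else 0) fun m hm y hy =>
    Comp.ite (.lt hy (hg.mono hm)) (hf.mono hm) (.const 0)).of_eq fun v A => ?_
  rw [← Finset.sum_filter, Finset.sum_const]
  have : Finset.filter (fun j => j < g v A) (Finset.range (v 0)) =
      Finset.range (min (g v A) (v 0)) := by ext j; simp [and_comm]
  rw [this]
  simp [mulB, mul_comm]

/-- The quotient `x / y` if it is at most `B`. -/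
def divB (B x y : ℕ) : ℕ := ∑ j ∈ Finset.range B, if mulB B y (j + 1) ≤ x then 1 else 0

/-- The quotient is the number of positive multiples of `y` that do not exceed `x`. -/
theorem divB_eq {B x y : ℕ} (hy : 0 < y) (h : x / y ≤ B) : divB B x y = x / y := by
  rw [divB, ← Finset.sum_filter]
  have : Finset.filter (fun j => mulB B y (j + 1) ≤ x) (Finset.range B) =
      Finset.range (x / y) := by
    ext j
    simp only [Finset.mem_filter, Finset.mem_range]
    constructor
    · rintro ⟨h1, h2⟩
      rw [mulB_eq h1] at h2
      exact (Nat.le_div_iff_mul_le hy).2 (by rwa [mul_comm])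
    · intro h1
      refine ⟨by omega, ?_⟩
      rw [mulB_eq (by omega), mul_comm]
      exact (Nat.le_div_iff_mul_le hy).1 h1
  rw [this]
  simp

theorem Comp.div (hf : Comp n f) (hg : Comp n g) : Comp n fun v A => divB (v 0) (f v A) (g v A) :=
  Comp.sum fun _ hm _ hy => .ite
    (.le (.mul (hg.mono hm) (hy.add (.const 1))) (hf.mono hm)) (.const 1) (.const 0)

/-- The remainder `x % y` if `x / y` is at most `B`. -/
def modB (B x y : ℕ) : ℕ := x - mulB B y (divB B x y)

theorem modB_eq {B x y : ℕ} (hy : 0 < y) (h : x / y ≤ B) : modB B x y = x % y := by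
  rw [modB, divB_eq hy h, mulB_eq h]
  have := Nat.div_add_mod x y
  omega

theorem Comp.mod (hf : Comp n f) (hg : Comp n g) : Comp n fun v A => modB (v 0) (f v A) (g v A) :=
  .sub hf (.mul hg (.div hf hg))

/-! ### Array transformations -/

/-- The array transformation `T` can be performed in time polynomial in register `0`. -/
def CompT (n : ℕ) (T : (ℕ → ℕ) → Arr → Arr) : Prop :=
  (∀ v v', (∀ i ≤ n, v i = v' i) → ∀ A, T v A = T v' A) ∧
  ∀ m ≥ n, ∃ (P : Prog) (p : Polynomial ℕ), ∀ s A, s.mem = flat A →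
    Runs P s (p.eval (s.reg 0)) fun s' => s'.mem = flat (T s.reg A) ∧ s'.out = s.out ∧
      ∀ i ≤ m, s'.reg i = s.reg i

variable {T U : (ℕ → ℕ) → Arr → Arr}

theorem CompT.seq (hT : CompT n T) (hU : CompT n U) : CompT n fun v A => U v (T v A) := by
  refine ⟨fun v v' h A => by simp only [hT.1 v v' h, hU.1 v v' h], fun m hm => ?_⟩
  obtain ⟨P, p, hP⟩ := hT.2 m hm
  obtain ⟨Q, q, hQ⟩ := hU.2 m hm
  refine ⟨.seq P Q, p + q, fun s A hs => ?_⟩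
  rw [Polynomial.eval_add]
  refine .seq ((hP s A hs).mono le_rfl fun s1 ⟨h1, h2, h3⟩ => ?_)
  have := hQ s1 _ h1
  rw [h3 0 (by omega)] at this
  refine this.mono le_rfl fun s2 ⟨k1, k2, k3⟩ => ⟨?_, k2.trans h2, fun i hi =>
    (k3 i hi).trans (h3 i hi)⟩
  rw [k1, hU.1 s1.reg s.reg fun i hi => h3 i (by omega)]

theorem CompT.ite [∀ v A, Decidable (p v A)] (hp : CompP n p) (hT : CompT n T) (hU : CompT n U) :
    CompT n fun v A => if p v A then T v A else U v A := by
  refine ⟨fun v v' h A => ?_, fun m hm => ?_⟩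
  · have hpv : p v A ↔ p v' A := by
      have := hp.1 v v' h A
      by_cases h1 : p v A <;> by_cases h2 : p v' A <;> simp_all
    simp only [hT.1 v v' h, hU.1 v v' h, hpv]
  obtain ⟨C, c', hC⟩ := hp.2 m hm
  obtain ⟨P, p, hP⟩ := hT.2 m hm
  obtain ⟨Q, q, hQ⟩ := hU.2 m hm
  refine ⟨.seq C (.branch (m + 1) P Q), c' + (p + q + 1), fun s A hs => ?_⟩
  simp only [Polynomial.eval_add, Polynomial.eval_one]
  refine .seq ((hC s A hs).mono le_rfl fun s1 ⟨h1, h2, h3, h4⟩ => .branch (fun h => ?_) fun h => ?_)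
  · refine (hP s1 A (h1.trans hs)).mono (by rw [h3 0 (by omega)]; omega)
      fun s2 ⟨k1, k2, k3⟩ => ⟨?_, k2.trans h2, fun i hi => (k3 i hi).trans (h3 i hi)⟩
    rw [k1, if_pos, hT.1 _ _ fun i hi => h3 i (by omega)]
    by_contra hn
    simp [h4, hn] at h
  · refine (hQ s1 A (h1.trans hs)).mono (by rw [h3 0 (by omega)]; omega)
      fun s2 ⟨k1, k2, k3⟩ => ⟨?_, k2.trans h2, fun i hi => (k3 i hi).trans (h3 i hi)⟩
    rw [k1, if_neg, hU.1 _ _ fun i hi => h3 i (by omega)]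
    intro hn
    simp [h4, hn] at h

theorem CompT.skip : CompT n fun _ A => A :=
  ⟨fun _ _ _ _ => rfl, fun m _ => ⟨.op (.const (m + 1) 0), 1, fun s A hs => by
    rw [Polynomial.eval_one]
    exact .op ⟨hs, rfl, fun i hi => Function.update_of_ne (by omega) _ _⟩⟩⟩

theorem CompT.set (k : Fin 8) (hf : Comp n f) (hg : Comp n g) :
    CompT n fun v A => setCell A k (f v A) (g v A) := by
  refine ⟨fun v v' h A => by simp only [hf.1 v v' h, hg.1 v v' h], fun m hm => ?_⟩
  obtain ⟨P, p, hP⟩ := hf.2 m hm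
  obtain ⟨Q, q, hQ⟩ := hg.2 (m + 1) (by omega)
  refine ⟨.seq P (.seq Q (ops [.add (m + 1) (m + 1) (m + 1), .add (m + 1) (m + 1) (m + 1),
    .add (m + 1) (m + 1) (m + 1), .const (m + 3) k, .add (m + 1) (m + 1) (m + 3)]
    (.op (.store (m + 1) (m + 2))))), p + (q + 6), fun s A hs => ?_⟩
  have : (p + (q + 6)).eval (s.reg 0) = p.eval (s.reg 0) + (q.eval (s.reg 0) + (5 + 1)) := by
    simp
  rw [this]
  refine .seq ((hP s A hs).mono le_rfl fun s1 ⟨h1, h2, h3, h4⟩ => ?_)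
  have := hQ s1 A (h1.trans hs)
  rw [h3 0 (by omega)] at this
  refine .seq (this.mono le_rfl fun s2 ⟨k1, k2, k3, k4⟩ => .ops (.op ?_))
  refine ⟨?_, k2.trans h2, fun i hi => ?_⟩
  · rw [flat_setCell, ← hs, ← h1, ← k1, ← hg.1 s1.reg s.reg (fun i hi => h3 i (by omega)) A, ← k4,
      ← h4, ← k3 _ le_rfl]
    simp [Op.apply]
    congr 1
    omega
  · have e1 : i ≠ m + 1 := by omega
    have e3 : i ≠ m + 3 := by omega
    simp [Op.apply, e1, e3, k3 i (by omega), h3 i hi]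

/-- Perform the transformations `H 0`, …, `H (B - 1)` one after the other. -/
def iter (H : ℕ → Arr → Arr) : ℕ → Arr → Arr
  | 0, A => A
  | B + 1, A => H B (iter H B A)

theorem iter_inv {H : ℕ → Arr → Arr} {B : ℕ} {A : Arr} (Inv : ℕ → Arr → Prop) (h0 : Inv 0 A)
    (h : ∀ i < B, ∀ A, Inv i A → Inv (i + 1) (H i A)) : Inv B (iter H B A) := by
  suffices ∀ k ≤ B, Inv k (iter H k A) from this B le_rfl
  intro k
  induction k with
  | zero => exact fun _ => h0
  | succ k ih => exact fun hk => h k hk _ (ih (by omega))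

theorem CompT.iter {H : (ℕ → ℕ) → ℕ → Arr → Arr}
    (h : ∀ m ≥ n, ∀ y : (ℕ → ℕ) → ℕ, Comp m (fun v _ => y v) → CompT m fun v A => H v (y v) A) :
    CompT n fun v A => iter (H v) (v 0) A := by
  have hind : ∀ v v', (∀ i ≤ n, v i = v' i) → H v = H v' := fun v v' hv => by
    funext j A
    exact (h n le_rfl (fun _ => j) (.const j)).1 v v' hv A
  refine ⟨fun v v' hv A => by simp only [hv 0 (by omega), hind v v' hv], fun m hm => ?_⟩
  obtain ⟨P, p, hP⟩ := (h (m + 2) (by omega) (fun v => v (m + 2)) (.var le_rfl)).2 (m + 2) le_rfl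
  refine ⟨ops [.copy (m + 1) 0] (.loop (m + 1)
    (ops [.sub (m + 2) 0 (m + 1)] (.seq P (ops [.const (m + 3) 1]
      (.op (.sub (m + 1) (m + 1) (m + 3))))))),
    1 + (Polynomial.X * ((1 + (p + 2)) + 1) + 1), fun s A hs => ?_⟩
  set B := s.reg 0 with hB
  have hev : (1 + (Polynomial.X * ((1 + (p + 2)) + 1) + 1)).eval B =
      1 + (B * ((1 + (p.eval B + 2)) + 1) + 1) := by simp
  rw [hev]
  refine Runs.ops (l := [_]) ((Runs.loop (fun j s' => s'.mem = flat (Ram.iter (H s.reg) j A) ∧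
      s'.out = s.out ∧ ∀ i ≤ m, s'.reg i = s.reg i) ?_ ?_ ?_).mono le_rfl fun s' h => h)
  · rintro i s1 hi ⟨h1, h2, h3⟩ hc
    refine Runs.ops (l := [_]) (.seq ?_)
    have := hP (Op.apply (.sub (m + 2) 0 (m + 1)) s1) _ h1
    have h0 : (Op.apply (.sub (m + 2) 0 (m + 1)) s1).reg 0 = B := by
      simp [Op.apply, h3, hB]
    rw [h0] at this
    refine this.mono le_rfl fun s2 ⟨k1, k2, k3⟩ => Runs.ops (l := [_]) (.op ?_)
    have hreg : ∀ i ≤ m + 1, s2.reg i = s1.reg i := fun i hi => by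
      rw [k3 i (by omega)]
      exact Function.update_of_ne (by omega) _ _
    refine ⟨⟨k1.trans ?_, k2.trans h2, fun i hi => ?_⟩, ?_⟩
    · have e : (Op.apply (.sub (m + 2) 0 (m + 1)) s1).reg (m + 2) = i := by
        simp [Op.apply, h3, hc]; omega
      simp only [e, Ram.iter]
      rw [hind _ s.reg fun j hj => ?_]
      rw [← h3 j (by omega)]
      exact Function.update_of_ne (by omega) _ _
    · have e1 : i ≠ m + 1 := by omega
      have e2 : i ≠ m + 3 := by omega
      simp [Op.apply, e1, e2, hreg i (by omega), h3 i hi]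
    · simp [Op.apply, hreg, hc]
      omega
  · refine ⟨hs, rfl, fun i hi => ?_⟩
    have e1 : i ≠ m + 1 := by omega
    simp [Op.apply, e1]
  · simp [Op.apply, hB]

/-- Evaluate an expression and use its value as a variable. -/
theorem CompT.bind {H : (ℕ → ℕ) → ℕ → Arr → Arr} (hf : Comp n f)
    (h : ∀ m ≥ n, ∀ y : (ℕ → ℕ) → ℕ, Comp m (fun v _ => y v) → CompT m fun v A => H v (y v) A) :
    CompT n fun v A => H v (f v A) A := by
  have hind : ∀ v v', (∀ i ≤ n, v i = v' i) → H v = H v' := fun v v' hv => by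
    funext j A
    exact (h n le_rfl (fun _ => j) (.const j)).1 v v' hv A
  refine ⟨fun v v' hv A => by simp only [hf.1 v v' hv A, hind v v' hv], fun m hm => ?_⟩
  obtain ⟨P, p, hP⟩ := hf.2 m hm
  obtain ⟨Q, q, hQ⟩ := (h (m + 1) (by omega) (fun v => v (m + 1)) (.var le_rfl)).2 (m + 1) le_rfl
  refine ⟨.seq P Q, p + q, fun s A hs => ?_⟩
  rw [Polynomial.eval_add]
  refine .seq ((hP s A hs).mono le_rfl fun s1 ⟨h1, h2, h3, h4⟩ => ?_)
  have := hQ s1 A (h1.trans hs)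
  rw [h3 0 (by omega)] at this
  refine this.mono le_rfl fun s2 ⟨k1, k2, k3⟩ => ⟨k1.trans ?_, k2.trans h2, fun i hi =>
    (k3 i (by omega)).trans (h3 i hi)⟩
  simp only [h4]
  rw [hind s1.reg s.reg fun i hi => h3 i (by omega)]

end Ram

/-! ### Perfect matchings by auction -/

/-- A perfect matching between `0, …, P - 1` and `0, …, P - 1` within the relation `al`. -/
def HasMatching (P : ℕ) (al : ℕ → ℕ → Prop) : Prop :=
  ∃ f : ℕ → ℕ, (∀ i < P, f i < P ∧ al i (f i)) ∧ ∀ i < P, ∀ i' < P, f i = f i' → i = i'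

/-- Invariant of the auction: object `j` has price `p j`, and is owned by the person `o j - 1` if
`o j ≠ 0`; up to one unit every owner holds a cheapest admissible object. -/
structure AuctionInv (P : ℕ) (al : ℕ → ℕ → Prop) (o p : ℕ → ℕ) : Prop where
  owner_le : ∀ j < P, o j ≤ P
  zero : ∀ j < P, o j = 0 ↔ p j = 0
  near : ∀ j < P, ∀ i, o j = i + 1 → al i j ∧ ∀ j' < P, al i j' → p j ≤ p j' + 1
  inj : ∀ j < P, ∀ j' < P, o j = o j' → o j ≠ 0 → j = j'
  bound : ∀ j < P, p j ≤ P + 1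

variable {P : ℕ} {al : ℕ → ℕ → Prop} {o p : ℕ → ℕ}

/-- Prices only rise, so the other owners still hold an admissible object within one unit of their
cheapest. The bidder pays one unit more than its minimum, which is just the slack that `near`
allows; a previous owner of `j` is displaced. -/
theorem AuctionInv.bid (h : AuctionInv P al o p) {i j : ℕ} (hi : i < P)
    (hfree : ∀ j < P, o j ≠ i + 1) (hj : j < P) (hal : al i j)
    (hmin : ∀ j' < P, al i j' → p j ≤ p j') (hp : p j < P + 1) :
    AuctionInv P al (Function.update o j (i + 1)) (Function.update p j (p j + 1)) := by
  have hle : ∀ j', p j' ≤ Function.update p j (p j + 1) j' := fun j' => by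
    by_cases e : j' = j
    · subst e; simp
    · simp [e]
  constructor
  · intro j' hj'
    by_cases e : j' = j
    · subst e; simp; omega
    · simpa [e] using h.owner_le j' hj'
  · intro j' hj'
    by_cases e : j' = j
    · subst e; simp
    · simpa [e] using h.zero j' hj'
  · intro j' hj' i' hi'
    by_cases e : j' = j
    · subst e
      simp only [Function.update_self] at hi' ⊢
      obtain rfl : i = i' := by omega
      refine ⟨hal, fun k hk hik => ?_⟩
      have := hmin k hk hik
      have := hle k
      omega
    · rw [Function.update_of_ne e] at hi' ⊢
      refine ⟨(h.near j' hj' i' hi').1, fun k hk hik => ?_⟩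
      have := (h.near j' hj' i' hi').2 k hk hik
      have := hle k
      omega
  · intro a ha b hb hab h0
    by_cases ea : a = j
    · by_cases eb : b = j
      · rw [ea, eb]
      · rw [ea, Function.update_self, Function.update_of_ne eb] at hab
        exact absurd hab.symm (hfree b hb)
    · by_cases eb : b = j
      · rw [eb, Function.update_self, Function.update_of_ne ea] at hab
        exact absurd hab (hfree a ha)
      · rw [Function.update_of_ne ea] at hab h0
        rw [Function.update_of_ne eb] at hab
        exact h.inj a ha b hb hab h0
  · intro j' hj'
    by_cases e : j' = j
    · subst e; simp; omega
    · simpa [e] using h.bound j' hj'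

theorem AuctionInv.not_hasMatching (h : AuctionInv P al o p) {i : ℕ} (hi : i < P)
    (hfree : ∀ j < P, o j ≠ i + 1) (hhigh : ∀ j < P, al i j → P + 1 ≤ p j) :
    ¬ HasMatching P al := by
  rintro ⟨f, hf, hinj⟩
  -- At most `P` distinct prices cannot cover `P + 1` levels.
  obtain ⟨l, hl, hl'⟩ : ∃ l ∈ Finset.Icc 1 (P + 1), l ∉ (Finset.range P).image p := by
    by_contra! hcon
    have := (Finset.card_le_card hcon).trans Finset.card_image_le
    simp at this
  rw [Finset.mem_Icc] at hl
  have hne : ∀ j < P, p j ≠ l := fun j hj e =>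
    hl' (Finset.mem_image.2 ⟨j, Finset.mem_range.2 hj, e⟩)
  set R := (Finset.range P).filter fun j => l < p j with hR
  have hRpos : ∀ j ∈ R, j < P ∧ l < p j ∧ o j ≠ 0 := fun j hj => by
    simp only [hR, Finset.mem_filter, Finset.mem_range] at hj
    refine ⟨hj.1, hj.2, fun h0 => ?_⟩
    have := (h.zero j hj.1).1 h0
    omega
  set S := insert i (R.image fun j => o j - 1) with hS
  have hcard : S.card = R.card + 1 := by
    rw [hS, Finset.card_insert_of_notMem, Finset.card_image_of_injOn]
    · intro a ha b hb hab
      have ha' := hRpos a ha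
      have hb' := hRpos b hb
      simp only at hab
      exact h.inj a ha'.1 b hb'.1 (by omega) ha'.2.2
    · intro hmem
      obtain ⟨j, hj, hji⟩ := Finset.mem_image.1 hmem
      have := hRpos j hj
      exact hfree j this.1 (by omega)
  -- The gap absorbs the slack of one unit: the object of an owner costs at least `l + 1`, so the
  -- admissible ones cost at least `l`, and none costs exactly `l`. For `i` itself `hhigh` gives at
  -- least `P + 1 ≥ l`.
  have hmaps : ∀ a ∈ S, a < P ∧ f a ∈ R := by
    intro a ha
    have haP : a < P := by
      rcases Finset.mem_insert.1 ha with rfl | ha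
      · exact hi
      · obtain ⟨j, hj, rfl⟩ := Finset.mem_image.1 ha
        have := hRpos j hj
        have := h.owner_le j this.1
        omega
    refine ⟨haP, ?_⟩
    obtain ⟨hfa, hal⟩ := hf a haP
    simp only [hR, Finset.mem_filter, Finset.mem_range]
    refine ⟨hfa, ?_⟩
    rcases Finset.mem_insert.1 ha with rfl | ha
    · have := hhigh _ hfa hal
      have := hne _ hfa
      omega
    · obtain ⟨j, hj, rfl⟩ := Finset.mem_image.1 ha
      have hj' := hRpos j hj
      have := (h.near j hj'.1 (o j - 1) (by omega)).2 _ hfa hal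
      have := hne _ hfa
      omega
  have hle : S.card ≤ R.card := Finset.card_le_card_of_injOn f (fun a ha => (hmaps a ha).2)
    fun a ha b hb hab => hinj a (hmaps a ha).1 b (hmaps b hb).1 hab
  omega

theorem AuctionInv.hasMatching (h : AuctionInv P al o p)
    (hall : ∀ i < P, ∃ j < P, o j = i + 1) : HasMatching P al := by
  choose! f hf using hall
  refine ⟨f, fun i hi => ⟨(hf i hi).1, (h.near _ (hf i hi).1 i (hf i hi).2).1⟩, ?_⟩
  intro i hi i' hi' e
  have h1 := (hf i hi).2
  have h2 := (hf i' hi').2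
  rw [e] at h1
  omega

/-! ### The auction on arrays -/

namespace Ram

/-- The least person without an object. -/
noncomputable def bidder (B P : ℕ) (A : Arr) : ℕ :=
  find B fun i => i < P ∧ ∀ j < B, j < P → A 5 j ≠ i + 1

/-- The first among the cheapest objects that are admissible for the person `i`. -/
noncomputable def cheapest (B P : ℕ) (al : ℕ → ℕ → Prop) (A : Arr) (i : ℕ) : ℕ :=
  find B fun j => j < P ∧ al i j ∧ ∀ j' < B, j' < P → al i j' → A 4 j ≤ A 4 j'

/-- The person `i` bids for the object `j`. Prices are in the array `4`, owners in the array `5`. -/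
def placeBid (P i j : ℕ) (A : Arr) : Arr :=
  if i < P ∧ j < P ∧ A 4 j < P + 1 then setCell (setCell A 5 j (i + 1)) 4 j (A 4 j + 1) else A

/-- One round of the auction. -/
noncomputable def auctionStep (B P : ℕ) (al : ℕ → ℕ → Prop) (A : Arr) : Arr :=
  placeBid P (bidder B P A) (cheapest B P al A (bidder B P A)) A

/-- Make all objects free and set all prices to zero. -/
def auctionReset (B : ℕ) (A : Arr) : Arr :=
  iter (fun j A => setCell (setCell A 5 j 0) 4 j 0) B A

/-- The auction; the number of objects and the admissible pairs may be read off the arrays. -/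
noncomputable def auction (B : ℕ) (P : Arr → ℕ) (al : Arr → ℕ → ℕ → Prop) (A : Arr) : Arr :=
  iter (fun _ A => auctionStep B (P A) (al A) A) B (auctionReset B A)

/-- Everybody has got an object. -/
def AuctionSuccess (B P : ℕ) (A : Arr) : Prop :=
  ∀ i < B, i < P → ∃ j < B, j < P ∧ A 5 j = i + 1

/-- The arrays other than prices and owners agree. -/
def SameData (A A' : Arr) : Prop := ∀ k, k ≠ 4 → k ≠ 5 → A' k = A k

theorem setCell_same (A : Arr) (k : Fin 8) (i x : ℕ) :
    setCell A k i x k = Function.update (A k) i x := by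
  simp [setCell]

theorem setCell_of_ne (A : Arr) {k k' : Fin 8} (i x : ℕ) (h : k' ≠ k) :
    setCell A k i x k' = A k' := by
  simp [setCell, h]

theorem SameData.setCell {A A' : Arr} (h : SameData A A') {k : Fin 8} (hk : k = 4 ∨ k = 5)
    (i x : ℕ) : SameData A (setCell A' k i x) := by
  intro k' h4 h5
  rw [setCell_of_ne, h k' h4 h5]
  rintro rfl
  tauto

theorem SameData.placeBid {A A' : Arr} (h : SameData A A') (P i j : ℕ) :
    SameData A (placeBid P i j A') := by
  unfold Ram.placeBid
  split_ifs
  · exact (h.setCell (.inr rfl) _ _).setCell (.inl rfl) _ _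
  · exact h

theorem auctionReset_spec (B : ℕ) (A : Arr) : SameData A (auctionReset B A) ∧
    ∀ j < B, auctionReset B A 4 j = 0 ∧ auctionReset B A 5 j = 0 := by
  refine iter_inv (fun t A' => SameData A A' ∧ ∀ j < t, A' 4 j = 0 ∧ A' 5 j = 0)
    ⟨fun _ _ _ => rfl, by simp⟩ ?_
  rintro i - A' ⟨h1, h2⟩
  refine ⟨(h1.setCell (.inr rfl) _ _).setCell (.inl rfl) _ _, fun j hj => ?_⟩
  rw [setCell_same, setCell_of_ne _ _ _ (by decide), setCell_of_ne _ _ _ (by decide), setCell_same]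
  by_cases e : j = i
  · subst e; simp
  · simpa [e] using h2 j (by omega)

/-- A round that raises no price changes nothing at all, and then the outcome is settled: either
nobody bids and the owners form a matching, or the bidder finds no admissible object below the price
cap and there is no matching. -/
theorem auctionStep_spec {A : Arr} (h : AuctionInv P al (A 5) (A 4)) {B : ℕ} (hB : P ≤ B) :
    AuctionInv P al (auctionStep B P al A 5) (auctionStep B P al A 4) ∧
      (∑ j ∈ Finset.range P, A 4 j + 1 ≤ ∑ j ∈ Finset.range P, auctionStep B P al A 4 j ∨
        auctionStep B P al A = A ∧ (AuctionSuccess B P A ↔ HasMatching P al)) := by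
  by_cases hex : ∃ i < B, i < P ∧ ∀ j < B, j < P → A 5 j ≠ i + 1
  swap
  · have hnot : auctionStep B P al A = A := by
      unfold auctionStep placeBid
      rw [if_neg]
      rintro ⟨h1, -⟩
      -- A failed search returns `B ≥ P`, which the guard of `placeBid` rejects.
      rw [bidder, find_eq hex] at h1
      omega
    have hsucc : ∀ i < P, ∃ j < P, A 5 j = i + 1 := by
      push Not at hex
      intro i hi
      obtain ⟨j, -, hj, e⟩ := hex i (by omega) hi
      exact ⟨j, hj, e⟩
    rw [hnot]
    refine ⟨h, .inr ⟨rfl, iff_of_true (fun i _ hi => ?_) (h.hasMatching hsucc)⟩⟩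
    obtain ⟨j, hj, e⟩ := hsucc i hi
    exact ⟨j, by omega, hj, e⟩
  have hbid := find_spec hex
  set i := bidder B P A with hi
  obtain ⟨-, hiP, hfree⟩ : i < B ∧ i < P ∧ ∀ j < B, j < P → A 5 j ≠ i + 1 := hbid
  have hfree' : ∀ j < P, A 5 j ≠ i + 1 := fun j hj => hfree j (by omega) hj
  have hfail : (∀ j < P, al i j → P + 1 ≤ A 4 j) →
      (AuctionSuccess B P A ↔ HasMatching P al) := fun hh => by
    refine iff_of_false (fun hs => ?_) (h.not_hasMatching hiP hfree' hh)
    obtain ⟨j, -, hj, e⟩ := hs i (by omega) hiP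
    exact hfree' j hj e
  by_cases hex2 : ∃ j < B, j < P ∧ al i j ∧ ∀ j' < B, j' < P → al i j' → A 4 j ≤ A 4 j'
  swap
  · have hnot : auctionStep B P al A = A := by
      unfold auctionStep placeBid
      rw [if_neg]
      rintro ⟨-, h1, -⟩
      rw [cheapest, ← hi, find_eq hex2] at h1
      omega
    rw [hnot]
    refine ⟨h, .inr ⟨rfl, hfail fun j hj hij => absurd ?_ hex2⟩⟩
    classical
    obtain ⟨j, hj, hmin⟩ := Finset.exists_min_image
      ((Finset.range P).filter fun j => al i j) (A 4) ⟨j, by simp [hj, hij]⟩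
    simp only [Finset.mem_filter, Finset.mem_range] at hj hmin
    exact ⟨j, by omega, hj.1, hj.2, fun j' _ h2 h3 => hmin j' ⟨h2, h3⟩⟩
  have hch := find_spec hex2
  set j := cheapest B P al A i with hj
  obtain ⟨-, hjP, hij, hmin⟩ : j < B ∧ j < P ∧ al i j ∧
    ∀ j' < B, j' < P → al i j' → A 4 j ≤ A 4 j' := hch
  have hmin' : ∀ j' < P, al i j' → A 4 j ≤ A 4 j' := fun j' h1 h2 => hmin j' (by omega) h1 h2
  have hstep : auctionStep B P al A = placeBid P i j A := rfl
  by_cases hp : A 4 j < P + 1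
  swap
  · have hnot : auctionStep B P al A = A := by
      rw [hstep, placeBid, if_neg fun h => hp h.2.2]
    rw [hnot]
    refine ⟨h, .inr ⟨rfl, hfail fun j' h1 h2 => ?_⟩⟩
    have := hmin' j' h1 h2
    omega
  rw [hstep, placeBid, if_pos ⟨hiP, hjP, hp⟩, setCell_same, setCell_of_ne _ _ _ (by decide),
    setCell_same, setCell_of_ne _ _ _ (by decide)]
  refine ⟨h.bid hiP hfree' hjP hij hmin' hp, .inl (Nat.succ_le_of_lt ?_)⟩
  refine Finset.sum_lt_sum (fun k _ => ?_) ⟨j, Finset.mem_range.2 hjP, by simp⟩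
  by_cases e : k = j
  · subst e; simp
  · simp [e]

/-- The prices sum to at most `P * (P + 1) < B`, so some of the `B` rounds is idle, and every later
round repeats it. The hypothesis `h` makes the size and the relation, which are read off the arrays,
insensitive to the arrays that the auction writes. -/
theorem auction_spec {B : ℕ} {A : Arr} {Pf : Arr → ℕ} {alf : Arr → ℕ → ℕ → Prop}
    (h : ∀ A', SameData A A' → Pf A' = P ∧ alf A' = al) (hB : P * (P + 1) < B) :
    SameData A (auction B Pf alf A) ∧
      (AuctionSuccess B P (auction B Pf alf A) ↔ HasMatching P al) := by
  have hPB : P ≤ B := by nlinarith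
  obtain ⟨r1, r2⟩ := auctionReset_spec B A
  have key := iter_inv (B := B) (H := fun _ A => auctionStep B (Pf A) (alf A) A)
    (A := auctionReset B A)
    (fun t A' => SameData A A' ∧ AuctionInv P al (A' 5) (A' 4) ∧
      (t ≤ ∑ j ∈ Finset.range P, A' 4 j ∨
        auctionStep B P al A' = A' ∧ (AuctionSuccess B P A' ↔ HasMatching P al))) ?_ ?_
  · obtain ⟨k1, k2, k3 | k3⟩ := key
    · have := Finset.sum_le_sum fun j (hj : j ∈ Finset.range P) => k2.bound j (Finset.mem_range.1 hj)
      simp only [Finset.sum_const, Finset.card_range, smul_eq_mul] at this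
      omega
    · exact ⟨k1, k3.2⟩
  · refine ⟨r1, ?_, .inl (Nat.zero_le _)⟩
    constructor <;> intro j hj <;> obtain ⟨h4, h5⟩ := r2 j (hj.trans_le hPB) <;> simp [h4, h5]
  · rintro t - A' ⟨k1, k2, k3⟩
    obtain ⟨e1, e2⟩ := h A' k1
    simp only [e1, e2]
    obtain ⟨s1, s2⟩ := auctionStep_spec k2 hPB
    refine ⟨k1.placeBid _ _ _, s1, ?_⟩
    rcases k3 with k3 | ⟨k3, k4⟩
    · rcases s2 with s2 | ⟨s2, s3⟩
      · exact .inl (by omega)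
      · rw [s2]; exact .inr ⟨s2, s3⟩
    · rw [k3]; exact .inr ⟨k3, k4⟩

end Ram

/-! ### Cardinality bounds as a matching problem -/

/-- Admissible pairs for the slots `v * r + c` of the values `v < d`: a row takes one of the first
`u v` slots of an admissible value; every other person takes a slot that is not among the first
`l v`. -/
def slotRel (r d : ℕ) (ok : ℕ → ℕ → Prop) (l u : ℕ → ℕ) (i z : ℕ) : Prop :=
  ∃ v < d, ∃ c < r, z = v * r + c ∧ (i < r ∧ ok i v ∧ c < u v ∨ r ≤ i ∧ l v ≤ c)

/-- A choice of admissible values for the rows with all cardinality bounds met. -/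
def GccSolvable (r d : ℕ) (ok : ℕ → ℕ → Prop) (l u : ℕ → ℕ) : Prop :=
  ∃ x : ℕ → ℕ, (∀ i < r, x i < d ∧ ok i (x i)) ∧
    ∀ v < d, l v ≤ ((Finset.range r).filter fun i => x i = v).card ∧
      ((Finset.range r).filter fun i => x i = v).card ≤ u v

variable {r d : ℕ} {ok : ℕ → ℕ → Prop} {l u : ℕ → ℕ}

theorem slot_inj {v v' c c' : ℕ} (hc : c < r) (hc' : c' < r) (h : v * r + c = v' * r + c') :
    v = v' ∧ c = c' := by
  have hr : 0 < r := by omega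
  rw [mul_comm v, mul_comm v'] at h
  have h1 := congrArg (· / r) h
  have h2 := congrArg (· % r) h
  simp only [Nat.mul_add_div hr, Nat.div_eq_of_lt hc, Nat.div_eq_of_lt hc'] at h1
  simp only [Nat.mul_add_mod, Nat.mod_eq_of_lt hc, Nat.mod_eq_of_lt hc'] at h2
  exact ⟨by omega, h2⟩

theorem slot_lt {v c : ℕ} (hv : v < d) (hc : c < r) : v * r + c < d * r := by
  have := Nat.mul_le_mul_right r (Nat.succ_le_of_lt hv)
  rw [Nat.succ_mul] at this
  omega

/-- A perfect matching fills every slot. The first `l v` slots of `v` are closed to dummies, hence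
are held by rows with value `v`; all rows with value `v` hold distinct slots numbered below `u v`.
-/
theorem gccSolvable_of_hasMatching (hl : ∀ v < d, l v ≤ r) (hd : 0 < d)
    (h : HasMatching (d * r) (slotRel r d ok l u)) : GccSolvable r d ok l u := by
  obtain ⟨f, hf, hinj⟩ := h
  have hrP : r ≤ d * r := Nat.le_mul_of_pos_left r hd
  have hf' := fun i hi => (hf i hi).2
  choose! x hx c hc hz hcase using hf'
  refine ⟨x, fun i hi => ⟨hx i (by omega), ?_⟩, fun v hv => ⟨?_, ?_⟩⟩
  · rcases hcase i (by omega) with h | h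
    · exact h.2.1
    · omega
  · have hsurj : ∀ z < d * r, ∃ i < d * r, f i = z := by
      have : (Finset.range (d * r)).image f = Finset.range (d * r) := by
        apply Finset.eq_of_subset_of_card_le
        · intro z hz
          obtain ⟨i, hi, rfl⟩ := Finset.mem_image.1 hz
          exact Finset.mem_range.2 (hf i (Finset.mem_range.1 hi)).1
        · rw [Finset.card_image_of_injOn]
          intro i hi i' hi' e
          exact hinj i (by simpa using hi) i' (by simpa using hi') e
      intro z hz
      have hz' := this ▸ Finset.mem_range.2 hz
      obtain ⟨i, hi, e⟩ := Finset.mem_image.1 hz'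
      exact ⟨i, Finset.mem_range.1 hi, e⟩
    choose! g hg hfg using hsurj
    have hk : ∀ k < l v, v * r + k < d * r := fun k hk =>
      slot_lt hv (hk.trans_le (hl v hv))
    rw [← Finset.card_range (l v)]
    refine Finset.card_le_card_of_injOn (fun k => g (v * r + k)) (fun k hkl => ?_) ?_
    · have hkl : k < l v := by simpa using hkl
      have hlr := hl v hv
      have hi := hg _ (hk k hkl)
      have e := hz _ hi
      rw [hfg _ (hk k hkl)] at e
      obtain ⟨e1, e2⟩ := slot_inj (by omega) (hc _ hi) e
      simp only [Finset.coe_filter, Finset.mem_range, Set.mem_ofPred_eq]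
      refine ⟨?_, e1.symm⟩
      rcases hcase _ hi with h | h
      · exact h.1
      · rw [← e1, ← e2] at h
        omega
    · intro k hkl k' hkl' e
      have hkl : k < l v := by simpa using hkl
      have hkl' : k' < l v := by simpa using hkl'
      have := congrArg f e
      simp only [hfg _ (hk k hkl), hfg _ (hk k' hkl')] at this
      omega
  · rw [← Finset.card_range (u v)]
    refine Finset.card_le_card_of_injOn c (fun i hi => ?_) ?_
    · simp only [Finset.coe_filter, Finset.mem_range, Set.mem_ofPred_eq] at hi
      have := hcase i (by omega)
      rw [hi.2] at this
      simp only [Finset.coe_range, Set.mem_Iio]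
      omega
    · intro i hi i' hi' e
      simp only [Finset.coe_filter, Finset.mem_range, Set.mem_ofPred_eq] at hi hi'
      refine hinj i (by omega) i' (by omega) ?_
      rw [hz i (by omega), hz i' (by omega), hi.2, hi'.2, e]

/-- Each row takes the slot whose number is its rank among the rows with the same value. The taken
slots are an initial segment of the block of `v`, of length at least `l v`, so the slots left over
are open to dummies, and there are exactly as many dummies as such slots. -/
theorem hasMatching_of_gccSolvable (hd : 0 < d) (h : GccSolvable r d ok l u) :
    HasMatching (d * r) (slotRel r d ok l u) := by
  obtain ⟨x, hx, hcnt⟩ := h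
  have hrP : r ≤ d * r := Nat.le_mul_of_pos_left r hd
  set cls : ℕ → Finset ℕ := fun v => (Finset.range r).filter fun i => x i = v with hcls
  set rank : ℕ → ℕ := fun i => ((cls (x i)).filter fun i' => i' < i).card with hrank
  have hmem : ∀ i < r, i ∈ cls (x i) := fun i hi => by simp [hcls, hi]
  have hrlt : ∀ i < r, rank i < (cls (x i)).card := fun i hi =>
    Finset.card_lt_card (Finset.filter_ssubset.2 ⟨i, hmem i hi, by simp⟩)
  have hclsle : ∀ v, (cls v).card ≤ r := fun v => by
    simpa using Finset.card_filter_le (Finset.range r) fun i => x i = v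
  have hmono : ∀ i < r, ∀ i' < r, x i = x i' → i < i' → rank i < rank i' := by
    intro i hi i' hi' e hlt
    refine Finset.card_lt_card ((Finset.ssubset_iff_of_subset fun k hk => ?_).2 ⟨i, ?_, ?_⟩)
    · rw [Finset.mem_filter] at hk ⊢
      exact ⟨e ▸ hk.1, hk.2.trans hlt⟩
    · rw [Finset.mem_filter]
      exact ⟨e ▸ hmem i hi, hlt⟩
    · simp
  have hrinj : ∀ i < r, ∀ i' < r, x i = x i' → rank i = rank i' → i = i' := by
    intro i hi i' hi' e e'
    rcases lt_trichotomy i i' with hlt | rfl | hlt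
    · have := hmono i hi i' hi' e hlt; omega
    · rfl
    · have := hmono i' hi' i hi e.symm hlt; omega
  set g : ℕ → ℕ := fun i => x i * r + rank i with hg
  have hginj : ∀ i < r, ∀ i' < r, g i = g i' → i = i' := by
    intro i hi i' hi' e
    obtain ⟨e1, e2⟩ := slot_inj ((hrlt i hi).trans_le (hclsle _)) ((hrlt i' hi').trans_le (hclsle _)) e
    exact hrinj i hi i' hi' e1 e2
  have hgP : ∀ i < r, g i < d * r := fun i hi =>
    slot_lt (hx i hi).1 ((hrlt i hi).trans_le (hclsle _))
  have hrsurj : ∀ v < d, ∀ k < (cls v).card, ∃ i < r, x i = v ∧ rank i = k := by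
    intro v hv k hk
    have : (cls v).image rank = Finset.range (cls v).card := by
      apply Finset.eq_of_subset_of_card_le
      · intro k hk
        obtain ⟨i, hi, rfl⟩ := Finset.mem_image.1 hk
        simp only [hcls, Finset.mem_filter, Finset.mem_range] at hi
        have := hrlt i hi.1
        rw [hi.2] at this
        exact Finset.mem_range.2 this
      · rw [Finset.card_image_of_injOn, Finset.card_range]
        intro i hi i' hi' e
        simp only [hcls, Finset.coe_filter, Finset.mem_range, Set.mem_ofPred_eq] at hi hi'
        exact hrinj i hi.1 i' hi'.1 (hi.2.trans hi'.2.symm) e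
    have hk' := this ▸ Finset.mem_range.2 hk
    obtain ⟨i, hi, e⟩ := Finset.mem_image.1 hk'
    simp only [hcls, Finset.mem_filter, Finset.mem_range] at hi
    exact ⟨i, hi.1, hi.2, e⟩
  set T := Finset.range (d * r) \ (Finset.range r).image g with hT
  have hTcard : T.card = d * r - r := by
    rw [hT, Finset.card_sdiff_of_subset, Finset.card_image_of_injOn]
    · simp
    · intro i hi i' hi' e
      exact hginj i (by simpa using hi) i' (by simpa using hi') e
    · intro z hz
      obtain ⟨i, hi, rfl⟩ := Finset.mem_image.1 hz
      exact Finset.mem_range.2 (hgP i (Finset.mem_range.1 hi))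
  -- An enumeration of the slots left over; the value 0 outside the range is never used.
  set t : ℕ → ℕ := fun i => if h : i < d * r - r then T.orderEmbOfFin hTcard ⟨i, h⟩ else 0 with ht
  have htT : ∀ i < d * r - r, t i ∈ T := fun i hi => by
    simp only [ht, hi, dif_pos]
    exact Finset.orderEmbOfFin_mem ..
  have htg : ∀ i < r, ∀ i' < d * r - r, g i ≠ t i' := fun i hi i' hi' e => by
    have := htT i' hi'
    rw [← e, hT, Finset.mem_sdiff] at this
    exact this.2 (Finset.mem_image_of_mem g (Finset.mem_range.2 hi))
  refine ⟨fun i => if i < r then g i else t (i - r), fun i hi => ?_, fun i hi i' hi' e => ?_⟩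
  · by_cases hir : i < r
    · simp only [hir, if_true]
      refine ⟨hgP i hir, x i, (hx i hir).1, rank i, (hrlt i hir).trans_le (hclsle _), rfl,
        .inl ⟨hir, (hx i hir).2, (hrlt i hir).trans_le (hcnt _ (hx i hir).1).2⟩⟩
    · simp only [hir, if_false]
      have hm := htT (i - r) (by omega)
      rw [hT, Finset.mem_sdiff, Finset.mem_range] at hm
      refine ⟨hm.1, ?_⟩
      have hr : 0 < r := by
        rcases Nat.eq_zero_or_pos r with rfl | h
        · simp at hi
        · exact h
      set z := t (i - r) with hz
      have hv : z / r < d := (Nat.div_lt_iff_lt_mul hr).2 hm.1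
      refine ⟨z / r, hv, z % r, Nat.mod_lt _ hr, by rw [mul_comm, Nat.div_add_mod],
        .inr ⟨by omega, ?_⟩⟩
      by_contra hlt
      obtain ⟨k, hk, e1, e2⟩ := hrsurj (z / r) hv (z % r)
        ((not_le.1 hlt).trans_le (hcnt _ hv).1)
      refine hm.2 (Finset.mem_image.2 ⟨k, Finset.mem_range.2 hk, ?_⟩)
      simp only [hg]
      rw [e1, e2, mul_comm, Nat.div_add_mod]
  · by_cases hir : i < r <;> by_cases hir' : i' < r <;> simp only [hir, hir', if_true, if_false] at e
    · exact hginj i hir i' hir' e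
    · exact absurd e (htg i hir _ (by omega))
    · exact absurd e.symm (htg i' hir' _ (by omega))
    · have h1 : i - r < d * r - r := by omega
      have h2 : i' - r < d * r - r := by omega
      simp only [ht, h1, h2, dif_pos] at e
      have := congrArg Fin.val ((T.orderEmbOfFin hTcard).injective e)
      simp only at this
      omega

/-- A lower bound above `r` has the same effect on the slots as the bound `r`, so it has to be
excluded separately. -/
theorem hasMatching_iff_gccSolvable (hd : 0 < d) :
    (∀ v < d, l v ≤ r) ∧ HasMatching (d * r) (slotRel r d ok l u) ↔ GccSolvable r d ok l u := by
  refine ⟨fun h => gccSolvable_of_hasMatching h.1 hd h.2, fun h =>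
    ⟨fun v hv => ?_, hasMatching_of_gccSolvable hd h⟩⟩
  obtain ⟨x, -, hcnt⟩ := h
  refine (hcnt v hv).1.trans ?_
  simpa using Finset.card_filter_le (Finset.range r) fun i => x i = v

/-! ### Layout of the encoded instance -/

/-- `S i` is the position where block `i` starts. Asking only for the recursion of partial sums
covers both constant strides and the varying lengths of the automata. -/
theorem getD_flatMap_finRange {n : ℕ} (f : Fin n → List ℕ) (S : ℕ → ℕ) (h0 : S 0 = 0)
    (hS : ∀ i : Fin n, S (i + 1) = S i + (f i).length) :
    ((List.finRange n).flatMap f).length = S n ∧ ∀ (i : Fin n) (k : ℕ), k < (f i).length →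
      S i + k < S n ∧ ((List.finRange n).flatMap f).getD (S i + k) 0 = (f i).getD k 0 := by
  induction n with
  | zero => exact ⟨by simp [h0], fun i => i.elim0⟩
  | succ n ih =>
    obtain ⟨h1, h2⟩ := ih (fun i => f i.castSucc) fun i => hS i.castSucc
    have hn : S (n + 1) = S n + (f (Fin.last n)).length := hS (Fin.last n)
    have hsplit : (List.finRange (n + 1)).flatMap f =
        (List.finRange n).flatMap (fun i => f i.castSucc) ++ f (Fin.last n) := by
      simp [List.finRange_succ_last, List.flatMap_append, List.flatMap_map]
    rw [hsplit]
    refine ⟨by rw [List.length_append, h1, hn], fun i k hk => ?_⟩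
    induction i using Fin.lastCases with
    | last =>
      refine ⟨by simp only [Fin.val_last]; omega, ?_⟩
      rw [List.getD_append_right _ _ _ _ (by rw [h1]; simp)]
      rw [h1, Fin.val_last, Nat.add_sub_cancel_left]
    | cast i =>
      obtain ⟨h3, h4⟩ := h2 i k hk
      refine ⟨by simp only [Fin.val_castSucc]; omega, ?_⟩
      rw [List.getD_append _ _ _ _ (by rw [h1]; exact h3)]
      exact h4

theorem getD_map_finRange {n : ℕ} (f : Fin n → ℕ) (k : Fin n) :
    ((List.finRange n).map f).getD k 0 = f k := by
  rw [List.getD_eq_getElem _ _ (by simp)]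
  simp

theorem getD_flatMap_map_finRange {n m : ℕ} (f : Fin n → Fin m → ℕ) :
    ((List.finRange n).flatMap fun i => (List.finRange m).map (f i)).length = n * m ∧
      ∀ (i : Fin n) (k : Fin m),
        ((List.finRange n).flatMap fun i => (List.finRange m).map (f i)).getD (i * m + k) 0 =
        f i k := by
  obtain ⟨h1, h2⟩ := getD_flatMap_finRange (fun i => (List.finRange m).map (f i)) (· * m)
    (by simp) fun i => by simp [Nat.succ_mul]
  refine ⟨h1, fun i k => ?_⟩
  rw [(h2 i k (by simp)).2, getD_map_finRange]

namespace RegularGcc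

variable (I : RegularGcc)

theorem length_encodeDomains (D : I.Domains) :
    (I.encodeDomains D).length = I.rows * I.cols * I.vals := by
  have := (getD_flatMap_finRange (fun i => (List.finRange I.cols).flatMap fun j =>
    (List.finRange I.vals).map fun v => if v ∈ D i j then 1 else 0) (· * (I.cols * I.vals))
    (by simp) fun i => by
      rw [(getD_flatMap_map_finRange _).1, Nat.succ_mul]).1
  rw [encodeDomains, this, mul_assoc]

theorem getD_encodeDomains (D : I.Domains) (i : Fin I.rows) (j : Fin I.cols) (v : Fin I.vals) :
    (i * I.cols + j) * I.vals + v < I.rows * I.cols * I.vals ∧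
    (I.encodeDomains D).getD ((i * I.cols + j) * I.vals + v) 0 = if v ∈ D i j then 1 else 0 := by
  have hlt := slot_lt (slot_lt i.2 j.2) v.2
  refine ⟨hlt, ?_⟩
  have := ((getD_flatMap_finRange (fun i => (List.finRange I.cols).flatMap fun j =>
    (List.finRange I.vals).map fun v => if v ∈ D i j then 1 else 0) (· * (I.cols * I.vals))
    (by simp) fun i => by
      rw [(getD_flatMap_map_finRange _).1, Nat.succ_mul]).2 i (j * I.vals + v)
      (by rw [(getD_flatMap_map_finRange _).1]; exact slot_lt j.2 v.2)).2
  rw [encodeDomains]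
  have e : (i * I.cols + j) * I.vals + v = i * (I.cols * I.vals) + (j * I.vals + v) := by ring
  rw [e, this, (getD_flatMap_map_finRange _).2]

theorem encodeDFA_spec {d q : ℕ} (M : DFA (Fin d) (Fin q)) :
    (encodeDFA M).length = 2 + q + q * d ∧ (encodeDFA M).getD 0 0 = q ∧
      (encodeDFA M).getD 1 0 = M.start ∧
      (∀ s : Fin q, (encodeDFA M).getD (2 + s) 0 ≠ 0 ↔ s ∈ M.accept) ∧
      ∀ (s : Fin q) (v : Fin d), (encodeDFA M).getD (2 + q + (s * d + v)) 0 = M.step s v := by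
  classical
  have hT := getD_flatMap_map_finRange fun s v => (M.step s v : ℕ)
  unfold encodeDFA
  refine ⟨?_, by simp, by simp, fun s => ?_, fun s v => ?_⟩
  · rw [List.length_append, hT.1]
    simp
    omega
  · rw [List.getD_append _ _ _ _ (by simp; omega), List.getD_append_right _ _ _ _ (by simp)]
    have := getD_map_finRange (fun s => if s ∈ M.accept then 1 else 0) s
    simp only [List.length_cons, List.length_nil, Nat.zero_add, Nat.reduceAdd,
      Nat.add_sub_cancel_left]
    rw [this]
    simp
  · rw [List.getD_append_right _ _ _ _ (by simp; omega)]
    rw [← hT.2]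
    congr 1
    simp
    omega

/-- The position in the encoding where the automaton of row `i` starts. -/
def offset (i : ℕ) : ℕ :=
  3 + ∑ k ∈ Finset.range i, if h : k < I.rows then 2 + I.states ⟨k, h⟩ + I.states ⟨k, h⟩ * I.vals else 0

theorem offset_succ (i : Fin I.rows) :
    I.offset (i + 1) = I.offset i + (2 + I.states i + I.states i * I.vals) := by
  rw [offset, Finset.sum_range_succ, dif_pos i.2, ← add_assoc]
  rfl

/-- The memory cell `m` of the encoding. -/
noncomputable def cell (m : ℕ) : ℕ := I.encode.getD m 0

theorem length_encode : I.encode.length =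
    I.offset I.rows + I.rows * I.cols * I.vals + 2 * (I.cols * I.vals) := by
  have h1 := (getD_flatMap_finRange (fun i => encodeDFA (I.aut i)) (fun i => I.offset i - 3)
    (by simp [offset]) fun i => by
      rw [(encodeDFA_spec _).1, offset_succ]
      have : 3 ≤ I.offset i := Nat.le_add_right ..
      omega).1
  have h2 : ∀ b : Fin I.cols → Fin I.vals → ℕ, (encodeBounds b).length = I.cols * I.vals :=
    fun b => (getD_flatMap_map_finRange b).1
  have : 3 ≤ I.offset I.rows := Nat.le_add_right ..
  simp only [encode, List.length_append, h1, h2, length_encodeDomains, List.length_cons,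
    List.length_nil]
  omega

theorem cell_zero : I.cell 0 = I.rows := by simp [cell, encode]
theorem cell_one : I.cell 1 = I.cols := by simp [cell, encode]
theorem cell_two : I.cell 2 = I.vals := by simp [cell, encode]

theorem cell_aut (i : Fin I.rows) {k : ℕ} (hk : k < (encodeDFA (I.aut i)).length) :
    I.cell (I.offset i + k) = (encodeDFA (I.aut i)).getD k 0 := by
  have h := getD_flatMap_finRange (fun i => encodeDFA (I.aut i)) (fun i => I.offset i - 3)
    (by simp [offset]) fun i => by
      rw [(encodeDFA_spec _).1, offset_succ]
      have : 3 ≤ I.offset i := Nat.le_add_right ..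
      omega
  have h3 : 3 ≤ I.offset i := Nat.le_add_right ..
  obtain ⟨h4, h5⟩ := h.2 i k hk
  simp only [cell, encode, List.append_assoc]
  rw [List.getD_append_right _ _ _ _ (by simp; omega),
    List.getD_append _ _ _ _ (by rw [h.1]; simp; omega), ← h5]
  congr 1
  simp
  omega

theorem cell_states (i : Fin I.rows) : I.cell (I.offset i) = I.states i := by
  obtain ⟨h1, h2, -⟩ := encodeDFA_spec (I.aut i)
  rw [← h2, ← cell_aut I i (by omega), add_zero]

theorem cell_start (i : Fin I.rows) : I.cell (I.offset i + 1) = (I.aut i).start := by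
  obtain ⟨h1, -, h2, -⟩ := encodeDFA_spec (I.aut i)
  rw [← h2, ← cell_aut I i (by omega)]

theorem cell_accept (i : Fin I.rows) (s : Fin (I.states i)) :
    I.cell (I.offset i + (2 + s)) ≠ 0 ↔ s ∈ (I.aut i).accept := by
  obtain ⟨h1, -, -, h2, -⟩ := encodeDFA_spec (I.aut i)
  rw [← h2, ← cell_aut I i (by omega)]

theorem cell_step (i : Fin I.rows) (s : Fin (I.states i)) (v : Fin I.vals) :
    I.cell (I.offset i + (2 + I.states i + (s * I.vals + v))) = (I.aut i).step s v := by
  obtain ⟨h1, -, -, -, h2⟩ := encodeDFA_spec (I.aut i)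
  have := slot_lt s.2 v.2
  rw [← h2, ← cell_aut I i (by omega)]

theorem cell_tail : (∀ k < I.rows * I.cols * I.vals,
      I.cell (I.offset I.rows + k) = (I.encodeDomains I.dom).getD k 0) ∧
    (∀ k < I.cols * I.vals, I.cell (I.offset I.rows + (I.rows * I.cols * I.vals + k)) =
      (encodeBounds I.lower).getD k 0) ∧
    ∀ k < I.cols * I.vals,
      I.cell (I.offset I.rows + (I.rows * I.cols * I.vals + (I.cols * I.vals + k))) =
        (encodeBounds I.upper).getD k 0 := by
  have h1 := (getD_flatMap_finRange (fun i => encodeDFA (I.aut i)) (fun i => I.offset i - 3)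
    (by simp [offset]) fun i => by
      rw [(encodeDFA_spec _).1, offset_succ]
      have : 3 ≤ I.offset i := Nat.le_add_right ..
      omega).1
  have h2 : ∀ b : Fin I.cols → Fin I.vals → ℕ, (encodeBounds b).length = I.cols * I.vals :=
    fun b => (getD_flatMap_map_finRange b).1
  have h3 : 3 ≤ I.offset I.rows := Nat.le_add_right ..
  have hA : ([I.rows, I.cols, I.vals] ++
      ((List.finRange I.rows).flatMap fun i => encodeDFA (I.aut i))).length = I.offset I.rows := by
    rw [List.length_append, h1]
    simp
    omega
  have hD := I.length_encodeDomains I.dom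
  have hE : I.encode = ([I.rows, I.cols, I.vals] ++
      ((List.finRange I.rows).flatMap fun i => encodeDFA (I.aut i))) ++
      (I.encodeDomains I.dom ++ (encodeBounds I.lower ++ encodeBounds I.upper)) := by
    rw [encode, List.append_assoc, List.append_assoc]
  simp only [cell, hE]
  refine ⟨fun k hk => ?_, fun k hk => ?_, fun k hk => ?_⟩
  · rw [List.getD_append_right _ _ _ _ (by omega), hA, Nat.add_sub_cancel_left,
      List.getD_append _ _ _ _ (by omega)]
  · rw [List.getD_append_right _ _ _ _ (by omega), hA, Nat.add_sub_cancel_left,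
      List.getD_append_right _ _ _ _ (by omega), hD, Nat.add_sub_cancel_left,
      List.getD_append _ _ _ _ (by rw [h2]; exact hk)]
  · rw [List.getD_append_right _ _ _ _ (by omega), hA, Nat.add_sub_cancel_left,
      List.getD_append_right _ _ _ _ (by omega), hD, Nat.add_sub_cancel_left,
      List.getD_append_right _ _ _ _ (by rw [h2]; omega), h2, Nat.add_sub_cancel_left]

theorem cell_dom (i : Fin I.rows) (j : Fin I.cols) (v : Fin I.vals) :
    I.cell (I.offset I.rows + ((i * I.cols + j) * I.vals + v)) ≠ 0 ↔ v ∈ I.dom i j := by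
  obtain ⟨h1, h2⟩ := I.getD_encodeDomains I.dom i j v
  rw [I.cell_tail.1 _ h1, h2]
  simp

theorem cell_lower (j : Fin I.cols) (v : Fin I.vals) :
    I.cell (I.offset I.rows + (I.rows * I.cols * I.vals + (j * I.vals + v))) = I.lower j v := by
  rw [I.cell_tail.2.1 _ (slot_lt j.2 v.2), encodeBounds, (getD_flatMap_map_finRange _).2]

theorem cell_upper (j : Fin I.cols) (v : Fin I.vals) :
    I.cell (I.offset I.rows + (I.rows * I.cols * I.vals + (I.cols * I.vals + (j * I.vals + v)))) =
      I.upper j v := by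
  rw [I.cell_tail.2.2 _ (slot_lt j.2 v.2), encodeBounds, (getD_flatMap_map_finRange _).2]

theorem offset_mono {i j : ℕ} (h : i ≤ j) : I.offset i ≤ I.offset j :=
  Nat.add_le_add_left (Finset.sum_le_sum_of_subset (by simpa using h)) _

theorem states_lt_length (i : Fin I.rows) : I.states i < I.encode.length := by
  have h1 := I.offset_succ i
  have h2 := I.offset_mono (Nat.succ_le_of_lt i.2)
  rw [Nat.succ_eq_add_one] at h2
  have := I.length_encode
  omega

/-- Every automaton occupies at least two cells, so the length of the encoding bounds the loops over
rows. -/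
theorem rows_lt_length : I.rows < I.encode.length := by
  have h : ∀ k ≤ I.rows, k < I.offset k := by
    intro k
    induction k with
    | zero => simp [offset]
    | succ k ih =>
      intro hk
      have := ih (by omega)
      have := I.offset_succ ⟨k, hk⟩
      simp only at this
      omega
  have := h _ le_rfl
  have := I.length_encode
  omega

end RegularGcc

/-! ### Codes of state tuples and the dynamic program over columns -/

theorem card_filter_range {r : ℕ} (p : ℕ → Prop) [DecidablePred p] :
    ((Finset.range r).filter p).card = (Finset.univ.filter fun i : Fin r => p i).card := by
  rw [← Finset.card_map Fin.valEmbedding]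
  congr 1
  ext i
  simp only [Finset.mem_filter, Finset.mem_range, Finset.mem_map, Finset.mem_univ, true_and,
    Fin.valEmbedding_apply]
  exact ⟨fun h => ⟨⟨i, h.1⟩, h.2, rfl⟩, fun ⟨a, h, e⟩ => e ▸ ⟨a.2, h⟩⟩

theorem gccSolvable_iff_fin {r d : ℕ} {ok : ℕ → ℕ → Prop} {l u : ℕ → ℕ} :
    GccSolvable r d ok l u ↔ ∃ x : Fin r → Fin d, (∀ i : Fin r, ok i (x i)) ∧
      ∀ v : Fin d, l v ≤ (Finset.univ.filter fun i => x i = v).card ∧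
        (Finset.univ.filter fun i => x i = v).card ≤ u v := by
  constructor
  · rintro ⟨x, hx, hc⟩
    refine ⟨fun i => ⟨x i, (hx i i.2).1⟩, fun i => (hx i i.2).2, fun v => ?_⟩
    have := hc v v.2
    rw [card_filter_range] at this
    simpa only [Fin.ext_iff] using this
  · rintro ⟨x, hx, hc⟩
    refine ⟨fun i => if h : i < r then x ⟨i, h⟩ else 0, fun i hi => ?_, fun v hv => ?_⟩
    · simp only [hi, dif_pos]
      exact ⟨(x _).2, hx ⟨i, hi⟩⟩
    · rw [card_filter_range]
      simpa [Fin.ext_iff] using hc ⟨v, hv⟩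

/-- The digit `i` of `a` in base `Q`. -/
def digit (Q a i : ℕ) : ℕ := a / Q ^ i % Q

/-- No state tuple is missed when the dynamic program inspects only codes below `Q ^ r`. -/
theorem exists_digits {Q r : ℕ} (s : Fin r → ℕ) (hs : ∀ i, s i < Q) :
    ∃ a < Q ^ r, ∀ i : Fin r, digit Q a i = s i := by
  refine ⟨finFunctionFinEquiv fun i => (⟨s i, hs i⟩ : Fin Q), Fin.is_lt _, fun i => ?_⟩
  have := congrFun (finFunctionFinEquiv.symm_apply_apply fun i => (⟨s i, hs i⟩ : Fin Q)) i
  exact congrArg Fin.val this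

namespace RegularGcc

variable (I : RegularGcc)

/-- The state of the automaton of row `i` after the first `j` columns of `M`. -/
def run (M : I.Assignment) (i : Fin I.rows) : ℕ → Fin (I.states i)
  | 0 => (I.aut i).start
  | j + 1 => if h : j < I.cols then (I.aut i).step (run M i j) (M i ⟨j, h⟩) else run M i j

theorem run_eq_eval_take (M : I.Assignment) (i : Fin I.rows) {j : ℕ} (hj : j ≤ I.cols) :
    I.run M i j = (I.aut i).eval ((List.ofFn (M i)).take j) := by
  induction j with
  | zero => simp [run]
  | succ j ih =>
    have hj' : j < (List.ofFn (M i)).length := by simpa using hj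
    rw [run, dif_pos (show j < I.cols from hj), ih (by omega), ← List.take_concat_get' _ _ hj',
      DFA.eval_append_singleton]
    simp

theorem run_cols (M : I.Assignment) (i : Fin I.rows) :
    I.run M i I.cols = (I.aut i).eval (List.ofFn (M i)) := by
  rw [run_eq_eval_take _ _ _ le_rfl, List.take_of_length_le (by simp)]

theorem run_congr {M M' : I.Assignment} (i : Fin I.rows) {j : ℕ}
    (h : ∀ k : Fin I.cols, k < j → M i k = M' i k) : I.run M i j = I.run M' i j := by
  induction j with
  | zero => rfl
  | succ j ih =>
    simp only [run]
    rw [ih fun k hk => h k (by omega)]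
    split_ifs with hj
    · rw [h ⟨j, hj⟩ (by simp)]
    · rfl

/-- The condition on column `j` of an assignment, the automata disregarded. -/
def ColumnOk (D : I.Domains) (M : I.Assignment) (j : Fin I.cols) : Prop :=
  (∀ i, M i j ∈ D i j) ∧ ∀ v, I.lower j v ≤ (Finset.univ.filter fun i => M i j = v).card ∧
    (Finset.univ.filter fun i => M i j = v).card ≤ I.upper j v

theorem isSolution_iff (D : I.Domains) (M : I.Assignment) :
    I.IsSolution D M ↔ (∀ j, I.ColumnOk D M j) ∧ ∀ i, I.run M i I.cols ∈ (I.aut i).accept := by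
  simp only [IsSolution, Holds, ColumnOk, run_cols, DFA.mem_accepts, forall_and]
  rw [forall_comm]
  tauto

/-- In row `i` the value `v` leads, in column `j`, from the state coded by `a` to that coded by
`b`. -/
def rowStep (D : I.Domains) (j : Fin I.cols) (a b i v : ℕ) : Prop :=
  ∃ (hi : i < I.rows) (hv : v < I.vals), (⟨v, hv⟩ : Fin I.vals) ∈ D ⟨i, hi⟩ j ∧
    ∃ h : digit I.maxStates a i < I.states ⟨i, hi⟩,
      ((I.aut ⟨i, hi⟩).step ⟨_, h⟩ ⟨v, hv⟩ : ℕ) = digit I.maxStates b i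

/-- The lower bounds of column `j`. -/
def lowerAt (j : Fin I.cols) (v : ℕ) : ℕ := if h : v < I.vals then I.lower j ⟨v, h⟩ else 0

/-- The upper bounds of column `j`. -/
def upperAt (j : Fin I.cols) (v : ℕ) : ℕ := if h : v < I.vals then I.upper j ⟨v, h⟩ else 0

/-- Some admissible column `j` leads from the states coded by `a` to those coded by `b`. -/
def colStep (D : I.Domains) (j : Fin I.cols) (a b : ℕ) : Prop :=
  GccSolvable I.rows I.vals (I.rowStep D j a b) (I.lowerAt j) (I.upperAt j)

/-- The states coded by `a` can be reached by the first `j` columns. -/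
def Reach (D : I.Domains) : ℕ → ℕ → Prop
  | 0, a => ∀ i : Fin I.rows, digit I.maxStates a i = (I.aut i).start
  | j + 1, b => ∃ a < I.maxStates ^ I.rows, Reach D j a ∧ ∃ hj : j < I.cols, I.colStep D ⟨j, hj⟩ a b

theorem colStep_iff (D : I.Domains) (j : Fin I.cols) (a b : ℕ) :
    I.colStep D j a b ↔ ∃ x : Fin I.rows → Fin I.vals,
      (∀ i, x i ∈ D i j) ∧ (∀ v, I.lower j v ≤ (Finset.univ.filter fun i => x i = v).card ∧
        (Finset.univ.filter fun i => x i = v).card ≤ I.upper j v) ∧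
      ∀ i : Fin I.rows, ∃ h : digit I.maxStates a i < I.states i,
        ((I.aut i).step ⟨_, h⟩ (x i) : ℕ) = digit I.maxStates b i := by
  rw [colStep, gccSolvable_iff_fin]
  refine exists_congr fun x => ?_
  constructor
  · rintro ⟨h1, h2⟩
    refine ⟨fun i => ?_, fun v => ?_, fun i => ?_⟩
    · obtain ⟨_, _, h, -⟩ := h1 i
      exact h
    · simpa [lowerAt, upperAt] using h2 v
    · obtain ⟨_, _, -, h⟩ := h1 i
      exact h
  · rintro ⟨h1, h2, h3⟩
    refine ⟨fun i => ⟨i.2, (x i).2, h1 i, h3 i⟩, fun v => ?_⟩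
    simpa [lowerAt, upperAt] using h2 v

theorem states_le_maxStates (i : Fin I.rows) : I.states i ≤ I.maxStates :=
  Finset.le_sup (f := I.states) (Finset.mem_univ i)

/-- Columns are linked only through the states between them. A partial assignment is extended by
overwriting column `j`, which affects neither the earlier columns nor the runs up to them;
conversely the states before column `j` supply the intermediate code. -/
theorem reach_iff (hd : 0 < I.vals) (D : I.Domains) {j : ℕ} (hj : j ≤ I.cols) (b : ℕ) :
    I.Reach D j b ↔ ∃ M : I.Assignment, (∀ k : Fin I.cols, k < j → I.ColumnOk D M k) ∧
      ∀ i, (I.run M i j : ℕ) = digit I.maxStates b i := by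
  induction j generalizing b with
  | zero =>
    simp only [Reach, run]
    -- Nothing is required of the columns from `j` on, but they must hold some value; this is where
    -- `hd` enters.
    exact ⟨fun h => ⟨fun _ _ => ⟨0, hd⟩, by simp, fun i => (h i).symm⟩,
      fun ⟨_, _, h⟩ i => (h i).symm⟩
  | succ j ih =>
    have hj' : j < I.cols := hj
    constructor
    · rintro ⟨a, -, hr, hj2, hs⟩
      obtain ⟨M, hM, hrun⟩ := (ih (by omega) a).1 hr
      obtain ⟨x, h1, h2, h3⟩ := (I.colStep_iff D ⟨j, hj'⟩ a b).1 hs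
      refine ⟨fun i => Function.update (M i) ⟨j, hj'⟩ (x i), fun k hk => ?_, fun i => ?_⟩
      · by_cases e : k = ⟨j, hj'⟩
        · subst e
          simpa [ColumnOk] using ⟨h1, h2⟩
        · have : (k : ℕ) < j := by
            have : (k : ℕ) ≠ j := fun h => e (Fin.ext h)
            omega
          simpa [ColumnOk, e] using hM k this
      · obtain ⟨h, h4⟩ := h3 i
        rw [run, dif_pos hj', ← h4, I.run_congr (M' := M) i]
        · simp only [Function.update_self]
          congr 2
          exact Fin.ext (hrun i)
        · intro k hk
          exact Function.update_of_ne (fun e => by simp [e] at hk) _ _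
    · rintro ⟨M, hM, hrun⟩
      obtain ⟨a, ha, hd⟩ := exists_digits (Q := I.maxStates) (fun i => (I.run M i j : ℕ))
        fun i => (I.run M i j).2.trans_le (I.states_le_maxStates i)
      refine ⟨a, ha, (ih (by omega) a).2 ⟨M, fun k hk => hM k (by omega), fun i => (hd i).symm⟩,
        hj', (I.colStep_iff D ⟨j, hj'⟩ a b).2 ⟨fun i => M i ⟨j, hj'⟩, ?_, ?_, fun i => ?_⟩⟩
      · exact (hM ⟨j, hj'⟩ (by simp)).1
      · exact (hM ⟨j, hj'⟩ (by simp)).2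
      · refine ⟨hd i ▸ (I.run M i j).2, ?_⟩
        rw [← hrun, run, dif_pos hj']
        congr 2
        exact Fin.ext (hd i)

/-- The states coded by `a` are accepting. -/
def Accepting (a : ℕ) : Prop :=
  ∀ i : Fin I.rows, ∃ h : digit I.maxStates a i < I.states i, ⟨_, h⟩ ∈ (I.aut i).accept

theorem exists_isSolution_iff (hd : 0 < I.vals) (D : I.Domains) :
    (∃ M, I.IsSolution D M) ↔
      ∃ a < I.maxStates ^ I.rows, I.Reach D I.cols a ∧ I.Accepting a := by
  simp only [isSolution_iff, I.reach_iff hd D le_rfl]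
  constructor
  · rintro ⟨M, h1, h2⟩
    obtain ⟨a, ha, hd⟩ := exists_digits (Q := I.maxStates) (fun i => (I.run M i I.cols : ℕ))
      fun i => (I.run M i I.cols).2.trans_le (I.states_le_maxStates i)
    refine ⟨a, ha, ⟨M, fun k _ => h1 k, fun i => (hd i).symm⟩, fun i => ⟨hd i ▸ (I.run M i _).2, ?_⟩⟩
    convert h2 i
    exact hd i
  · rintro ⟨a, -, ⟨M, h1, h2⟩, h3⟩
    refine ⟨M, fun j => h1 j j.2, fun i => ?_⟩
    obtain ⟨h, h4⟩ := h3 i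
    convert h4
    exact h2 i

/-- The domains with the variable and the value coded by `t` forced. -/
def forced (t : ℕ) : I.Domains := fun i j => (I.dom i j).filter fun v =>
  (i * I.cols + j) * I.vals ≤ t → t < (i * I.cols + j) * I.vals + I.vals →
    (i * I.cols + j) * I.vals + v = t

/-- Different variables own disjoint blocks of `I.vals` consecutive numbers, so `t` lies in the
block of one variable only and leaves the other domains untouched. -/
theorem isSolution_forced_iff (i : Fin I.rows) (j : Fin I.cols) (v : Fin I.vals)
    (M : I.Assignment) : I.IsSolution (I.forced ((i * I.cols + j) * I.vals + v)) M ↔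
      I.IsSolution I.dom M ∧ M i j = v := by
  simp only [IsSolution, forced, Finset.mem_filter]
  constructor
  · rintro ⟨h1, h2⟩
    refine ⟨⟨fun i j => (h1 i j).1, h2⟩, Fin.ext ?_⟩
    have := (h1 i j).2 (by omega) (by omega)
    omega
  · rintro ⟨⟨h1, h2⟩, h3⟩
    refine ⟨fun i' j' => ⟨h1 i' j', fun ha hb => ?_⟩, h2⟩
    obtain ⟨k, hk⟩ := Nat.exists_eq_add_of_le ha
    obtain ⟨e, -⟩ := slot_inj (r := I.vals) (c' := k) v.2 (by omega) hk
    obtain ⟨e1, e2⟩ := slot_inj j.2 j'.2 e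
    obtain rfl := Fin.ext e1
    obtain rfl := Fin.ext e2
    rw [h3]

open Classical in
/-- The values taken in some solution. -/
noncomputable def consistentDomains : I.Domains := fun i j =>
  Finset.univ.filter fun v => ∃ M, I.IsSolution I.dom M ∧ M i j = v

theorem mem_consistentDomains {i : Fin I.rows} {j : Fin I.cols} {v : Fin I.vals} :
    v ∈ I.consistentDomains i j ↔ ∃ M, I.IsSolution I.dom M ∧ M i j = v := by
  simp [consistentDomains]

/-- Restricting to the values taken in solutions loses no solution, so the witnesses for these
values survive and no further round of filtering is needed. -/
theorem enforcesDC_consistentDomains : I.EnforcesDC I.consistentDomains := by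
  have h : ∀ M, I.IsSolution I.dom M → I.IsSolution I.consistentDomains M := fun M hM =>
    ⟨fun i j => I.mem_consistentDomains.2 ⟨M, hM, rfl⟩, hM.2⟩
  refine ⟨fun i j v hv => ?_, fun i j v hv => ?_, h⟩
  · obtain ⟨M, hM, rfl⟩ := I.mem_consistentDomains.1 hv
    exact hM.1 i j
  · obtain ⟨M, hM, e⟩ := I.mem_consistentDomains.1 hv
    exact ⟨M, h M hM, e⟩

end RegularGcc

namespace Ram

/-! ### The program -/

/-- The digit `i` of `a` in base `A 7 1`, the powers of the base being in the array `7`. -/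
def digitA (B : ℕ) (A : Arr) (a i : ℕ) : ℕ := modB B (divB B a (A 7 i)) (A 7 1)

/-- The number of states of the automaton of row `i`. -/
def statesA (A : Arr) (i : ℕ) : ℕ := A 0 (A 1 i)

/-- The transition function of the automaton of row `i`. -/
def stepA (B : ℕ) (A : Arr) (i s v : ℕ) : ℕ :=
  A 0 (A 1 i + (2 + statesA A i + (mulB B s (A 0 2) + v)))

/-- The number of the first pair of variable and value for the variable in row `i` and column `j`. -/
def baseA (B : ℕ) (A : Arr) (i j : ℕ) : ℕ := mulB B (mulB B i (A 0 1) + j) (A 0 2)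

/-- The number of pairs of variables and values. -/
def sizeA (B : ℕ) (A : Arr) : ℕ := mulB B (mulB B (A 0 0) (A 0 1)) (A 0 2)

/-- The lower bounds of column `j`. -/
def lowerA (B : ℕ) (A : Arr) (j v : ℕ) : ℕ :=
  A 0 (A 1 (A 0 0) + (sizeA B A + (mulB B j (A 0 2) + v)))

/-- The upper bounds of column `j`. -/
def upperA (B : ℕ) (A : Arr) (j v : ℕ) : ℕ :=
  A 0 (A 1 (A 0 0) + (sizeA B A + (mulB B (A 0 1) (A 0 2) + (mulB B j (A 0 2) + v))))

/-- In row `i` the value `v` leads from the state coded by `a` to that coded by `b`. -/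
def RowStepA (B : ℕ) (A : Arr) (t j a b i v : ℕ) : Prop :=
  (A 0 (A 1 (A 0 0) + (baseA B A i j + v)) ≠ 0 ∧
    (baseA B A i j ≤ t → t < baseA B A i j + A 0 2 → baseA B A i j + v = t)) ∧
  digitA B A a i < statesA A i ∧ stepA B A i (digitA B A a i) v = digitA B A b i

/-- Admissible pairs of persons and slots for a column. -/
def SlotRelA (B : ℕ) (A : Arr) (t j a b i z : ℕ) : Prop :=
  ∃ v < B, v < A 0 2 ∧ ∃ c < B, c < A 0 0 ∧ z = mulB B v (A 0 0) + c ∧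
    (i < A 0 0 ∧ RowStepA B A t j a b i v ∧ c < upperA B A j v ∨
      A 0 0 ≤ i ∧ lowerA B A j v ≤ c)

/-- The number of slots. -/
def slotsA (B : ℕ) (A : Arr) : ℕ := mulB B (A 0 2) (A 0 0)

/-- The auction for the slots of column `j`. -/
noncomputable def columnAuction (B t j a b : ℕ) (A : Arr) : Arr :=
  auction B (slotsA B) (fun A => SlotRelA B A t j a b) A

open Classical in
/-- Mark `b` in the array `3` if the auction was a success and no lower bound is too large. -/
noncomputable def markSuccess (B j b : ℕ) (A : Arr) : Arr :=
  if (∀ v < B, v < A 0 2 → lowerA B A j v ≤ A 0 0) ∧ AuctionSuccess B (slotsA B A) A then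
    setCell A 3 b 1
  else A

/-- Mark `b` if it can be reached from the marked code `a` through column `j`. -/
noncomputable def transition (B t j a b : ℕ) (A : Arr) : Arr :=
  if (a < A 7 (A 0 0) ∧ b < A 7 (A 0 0)) ∧ A 2 a ≠ 0 then
    markSuccess B j b (columnAuction B t j a b A)
  else A

/-- Replace the marked codes, in the array `2`, by those reached through column `j`. -/
noncomputable def advance (B t j : ℕ) (A : Arr) : Arr :=
  iter (fun b A => setCell A 2 b (A 3 b)) B
    (iter (fun a A => iter (fun b A => transition B t j a b A) B A) B
      (iter (fun b A => setCell A 3 b 0) B A))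

/-- Replace the marked codes by those reached through column `j`, if there is such a column. -/
noncomputable def column (B t j : ℕ) (A : Arr) : Arr :=
  if j < A 0 1 then advance B t j A else A

open Classical in
/-- Mark the codes of the start states. -/
noncomputable def markStart (B : ℕ) (A : Arr) : Arr :=
  iter (fun a A => setCell A 2 a
    (if ∀ i < B, i < A 0 0 → digitA B A a i = A 0 (A 1 i + 1) then 1 else 0)) B A

/-- Accepting states are coded by `a`. -/
def AcceptingA (B : ℕ) (A : Arr) (a : ℕ) : Prop :=
  ∀ i < B, i < A 0 0 → digitA B A a i < statesA A i ∧ A 0 (A 1 i + (2 + digitA B A a i)) ≠ 0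

open Classical in
/-- Store in the cell `t` of the array `6` whether accepting states are coded by a marked code. -/
noncomputable def markAccept (B t : ℕ) (A : Arr) : Arr :=
  setCell A 6 t (if ∃ a < B, (a < A 7 (A 0 0) ∧ A 2 a ≠ 0) ∧ AcceptingA B A a then 1 else 0)

/-- Decide the existence of a solution with the pair of variable and value coded by `t`. -/
noncomputable def decidePair (B t : ℕ) (A : Arr) : Arr :=
  markAccept B t (iter (column B t) B (markStart B A))

/-- Decide the existence of solutions for all pairs of variables and values. -/
noncomputable def decideAll (B : ℕ) (A : Arr) : Arr := iter (decidePair B) B A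

/-- The largest number of states. -/
noncomputable def maxStatesA (B : ℕ) (A : Arr) : ℕ :=
  find B fun s => ∀ i < B, i < A 0 0 → statesA A i ≤ s

/-- Compute the positions of the automata in the array `1`. -/
def fillOffsets (B : ℕ) (A : Arr) : Arr :=
  iter (fun i A => setCell A 1 (i + 1)
    (A 1 i + (2 + statesA A i + mulB B (A 0 2) (statesA A i)))) B (setCell A 1 0 3)

/-- Compute the powers of the largest number of states in the array `7`. -/
noncomputable def fillPowers (B : ℕ) (A : Arr) : Arr :=
  iter (fun i A => setCell A 7 (i + 1) (mulB B (A 7 i) (maxStatesA B A))) B (setCell A 7 0 1)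

/-- A bound on the length of all loops of the main part. -/
def loopBound (B : ℕ) (A : Arr) : ℕ :=
  mulB B (mulB B (mulB B (mulB B (A 7 (A 0 0)) B) B) B) B

/-! ### The program runs in polynomial time -/

variable {n : ℕ} {x y z : (ℕ → ℕ) → Arr → ℕ}

theorem Comp.bound : Comp n fun v _ => v 0 := .var (Nat.zero_le n)

theorem Comp.input (k : ℕ) : Comp n fun _ A => A 0 k := .read 0 (.const k)

theorem comp_digitA (hx : Comp n x) (hy : Comp n y) :
    Comp n fun v A => digitA (v 0) A (x v A) (y v A) :=
  .mod (.div hx (.read 7 hy)) (.read 7 (.const 1))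

theorem comp_statesA (hx : Comp n x) : Comp n fun v A => statesA A (x v A) :=
  .read 0 (.read 1 hx)

theorem comp_stepA (hx : Comp n x) (hy : Comp n y) (hz : Comp n z) :
    Comp n fun v A => stepA (v 0) A (x v A) (y v A) (z v A) :=
  .read 0 (.add (.read 1 hx) (.add (.add (.const 2) (comp_statesA hx))
    (.add (.mul hy (.input 2)) hz)))

theorem comp_baseA (hx : Comp n x) (hy : Comp n y) :
    Comp n fun v A => baseA (v 0) A (x v A) (y v A) :=
  .mul (.add (.mul hx (.input 1)) hy) (.input 2)

theorem comp_sizeA : Comp n fun v A => sizeA (v 0) A :=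
  .mul (.mul (.input 0) (.input 1)) (.input 2)

theorem comp_lowerA (hx : Comp n x) (hy : Comp n y) :
    Comp n fun v A => lowerA (v 0) A (x v A) (y v A) :=
  .read 0 (.add (.read 1 (.input 0)) (.add comp_sizeA (.add (.mul hx (.input 2)) hy)))

theorem comp_upperA (hx : Comp n x) (hy : Comp n y) :
    Comp n fun v A => upperA (v 0) A (x v A) (y v A) :=
  .read 0 (.add (.read 1 (.input 0)) (.add comp_sizeA (.add (.mul (.input 1) (.input 2))
    (.add (.mul hx (.input 2)) hy))))

theorem comp_slotsA : Comp n fun v A => slotsA (v 0) A := .mul (.input 2) (.input 0)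

variable {t j a b : (ℕ → ℕ) → ℕ}

/-- `y` is a variable: its value can be computed without reference to the arrays. -/
abbrev CompV (n : ℕ) (y : (ℕ → ℕ) → ℕ) : Prop := Comp n fun v _ => y v

theorem compP_rowStepA (ht : CompV n t) (hj : CompV n j) (ha : CompV n a) (hb : CompV n b)
    (hx : Comp n x) (hy : Comp n y) :
    CompP n fun v A => RowStepA (v 0) A (t v) (j v) (a v) (b v) (x v A) (y v A) :=
  .and (.and (.ne_zero (.read 0 (.add (.read 1 (.input 0)) (.add (comp_baseA hx hj) hy))))
    (.imp (.le (comp_baseA hx hj) ht) (.imp (.lt ht (.add (comp_baseA hx hj) (.input 2)))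
      (.eq (.add (comp_baseA hx hj) hy) ht))))
    (.and (.lt (comp_digitA ha hx) (comp_statesA hx))
      (.eq (comp_stepA hx (comp_digitA ha hx) hy) (comp_digitA hb hx)))

theorem compP_slotRelA (ht : CompV n t) (hj : CompV n j) (ha : CompV n a) (hb : CompV n b)
    (hx : Comp n x) (hz : Comp n z) :
    CompP n fun v A => SlotRelA (v 0) A (t v) (j v) (a v) (b v) (x v A) (z v A) := by
  refine .ex fun m hm w hw => .and (.lt hw (.input 2)) (.ex fun m' hm' c hc => ?_)
  have hn := hm.trans hm'
  replace hw := hw.mono hm'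
  replace hx := hx.mono hn
  exact .and (.lt hc (.input 0)) (.and (.eq (hz.mono hn) (.add (.mul hw (.input 0)) hc))
    (.or (.and (.lt hx (.input 0)) (.and (compP_rowStepA (ht.mono hn) (hj.mono hn) (ha.mono hn)
      (hb.mono hn) hx hw) (.lt hc (comp_upperA (hj.mono hn) hw))))
      (.and (.le (.input 0) hx) (.le (comp_lowerA (hj.mono hn) hw) hc))))

theorem comp_bidder (hx : Comp n x) : Comp n fun v A => bidder (v 0) (x v A) A :=
  .find fun _ hm _ hy => .and (.lt hy (hx.mono hm)) (.all fun _ hm' _ hz =>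
    .imp (.lt hz (hx.mono (hm.trans hm'))) (.not (.eq (.read 5 hz) (.add (hy.mono hm') (.const 1)))))

theorem comp_cheapest {al : (ℕ → ℕ) → Arr → ℕ → ℕ → Prop}
    (hal : ∀ m ≥ n, ∀ x y, Comp m x → Comp m y → CompP m fun v A => al v A (x v A) (y v A))
    (hx : Comp n x) (hz : Comp n z) :
    Comp n fun v A => cheapest (v 0) (x v A) (al v A) A (z v A) :=
  .find fun m hm _ hy => .and (.lt hy (hx.mono hm)) (.and (hal m hm _ _ (hz.mono hm) hy)
    (.all fun m' hm' _ hw => .imp (.lt hw (hx.mono (hm.trans hm')))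
      (.imp (hal m' (hm.trans hm') _ _ (hz.mono (hm.trans hm')) hw)
        (.le (.read 4 (hy.mono hm')) (.read 4 hw)))))

theorem compT_auction {al : (ℕ → ℕ) → Arr → ℕ → ℕ → Prop}
    (hal : ∀ m ≥ n, ∀ x y, Comp m x → Comp m y → CompP m fun v A => al v A (x v A) (y v A))
    (hx : Comp n x) : CompT n fun v A => auction (v 0) (x v) (al v) A := by
  refine .seq (T := fun v A => auctionReset (v 0) A)
    (U := fun v A => iter (fun _ A => auctionStep (v 0) (x v A) (al v A) A) (v 0) A)
    (.iter (H := fun _ j A => setCell (setCell A 5 j 0) 4 j 0) fun m hm y hy =>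
      .seq (T := fun v A => setCell A 5 (y v) 0) (U := fun v A => setCell A 4 (y v) 0)
        (.set 5 hy (.const 0)) (.set 4 hy (.const 0)))
    (.iter (H := fun v _ A => auctionStep (v 0) (x v A) (al v A) A) fun m hm y hy => ?_)
  have hx' := hx.mono hm
  have hbid := comp_bidder hx'
  have hch := comp_cheapest (fun k hk => hal k (hm.trans hk)) hx' hbid
  -- Bidder, object and new price are evaluated first and kept in registers, because placing the bid
  -- changes the arrays they are read from.
  refine .bind (H := fun v i A =>
    placeBid (x v A) i (cheapest (v 0) (x v A) (al v A) A (bidder (v 0) (x v A) A)) A) hbid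
    fun m1 hm1 i hi => .bind (H := fun v k A => placeBid (x v A) (i v) k A) (hch.mono hm1)
    fun m2 hm2 k hk => ?_
  replace hi := hi.mono hm2
  replace hx' := hx'.mono (hm1.trans hm2)
  refine .ite (.and (.lt hi hx') (.and (.lt hk hx') (.lt (.read 4 hk) (.add hx' (.const 1))))) ?_
    .skip
  exact .bind (H := fun v w A => setCell (setCell A 5 (k v) (i v + 1)) 4 (k v) w)
    (.add (.read 4 hk) (.const 1)) fun m3 hm3 w hw =>
    .seq (T := fun v A => setCell A 5 (k v) (i v + 1)) (U := fun v A => setCell A 4 (k v) (w v))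
      (.set 5 (hk.mono hm3) (.add (hi.mono hm3) (.const 1))) (.set 4 (hk.mono hm3) hw)

theorem compP_auctionSuccess (hx : Comp n x) :
    CompP n fun v A => AuctionSuccess (v 0) (x v A) A :=
  .all fun _ hm _ hy => .imp (.lt hy (hx.mono hm)) (.ex fun _ hm' _ hz =>
    .and (.lt hz (hx.mono (hm.trans hm'))) (.eq (.read 5 hz) (.add (hy.mono hm') (.const 1))))

theorem compT_transition (ht : CompV n t) (hj : CompV n j) (ha : CompV n a) (hb : CompV n b) :
    CompT n fun v A => transition (v 0) (t v) (j v) (a v) (b v) A := by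
  classical
  have hQ : Comp n fun _ A => A 7 (A 0 0) := .read 7 (.input 0)
  refine .ite (.and (.and (.lt ha hQ) (.lt hb hQ)) (.ne_zero (.read 2 ha)))
    (.seq (T := fun v A => columnAuction (v 0) (t v) (j v) (a v) (b v) A)
      (U := fun v A => markSuccess (v 0) (j v) (b v) A)
      (compT_auction (al := fun v A => SlotRelA (v 0) A (t v) (j v) (a v) (b v))
        (fun m hm x y hx hy => ?_) comp_slotsA)
      (.ite (.and (.all fun m hm y hy => ?_) (compP_auctionSuccess comp_slotsA)) (.set 3 hb (.const 1))
        .skip)) .skip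
  · exact compP_slotRelA (ht.mono hm) (hj.mono hm) (ha.mono hm) (hb.mono hm) hx hy
  · exact .imp (.lt hy (.input 2)) (.le (comp_lowerA (hj.mono hm) hy) (.input 0))

theorem compT_advance (ht : CompV n t) (hj : CompV n j) :
    CompT n fun v A => advance (v 0) (t v) (j v) A :=
  .seq (T := fun v A => iter (fun a A => iter (fun b A => transition (v 0) (t v) (j v) a b A) (v 0) A)
      (v 0) (iter (fun b A => setCell A 3 b 0) (v 0) A))
    (U := fun v A => iter (fun b A => setCell A 2 b (A 3 b)) (v 0) A)
    (.seq (T := fun v A => iter (fun b A => setCell A 3 b 0) (v 0) A)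
      (U := fun v A => iter (fun a A =>
        iter (fun b A => transition (v 0) (t v) (j v) a b A) (v 0) A) (v 0) A)
      (.iter (H := fun _ b A => setCell A 3 b 0) fun _ _ _ hy => .set 3 hy (.const 0))
      (.iter (H := fun v a A => iter (fun b A => transition (v 0) (t v) (j v) a b A) (v 0) A)
        fun _ hm a ha => .iter (H := fun v b A => transition (v 0) (t v) (j v) (a v) b A)
        fun _ hm' _ hb => compT_transition (ht.mono (hm.trans hm')) (hj.mono (hm.trans hm'))
          (ha.mono hm') hb))
    (.iter (H := fun _ b A => setCell A 2 b (A 3 b)) fun _ _ _ hy => .set 2 hy (.read 3 hy))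

theorem compP_acceptingA (ha : Comp n x) : CompP n fun v A => AcceptingA (v 0) A (x v A) :=
  .all fun _ hm _ hy => .imp (.lt hy (.input 0)) (.and
    (.lt (comp_digitA (ha.mono hm) hy) (comp_statesA hy))
    (.ne_zero (.read 0 (.add (.read 1 hy) (.add (.const 2) (comp_digitA (ha.mono hm) hy))))))

theorem compT_markStart : CompT n fun v A => markStart (v 0) A := by
  classical
  exact .iter (H := fun v a A => setCell A 2 a
      (if ∀ i < v 0, i < A 0 0 → digitA (v 0) A a i = A 0 (A 1 i + 1) then 1 else 0))
    fun _ _ _ hy => .set 2 hy (.ite (.all fun _ hm _ hz => .imp (.lt hz (.input 0))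
      (.eq (comp_digitA (hy.mono hm) hz) (.read 0 (.add (.read 1 hz) (.const 1)))))
      (.const 1) (.const 0))

theorem compT_markAccept (ht : CompV n t) : CompT n fun v A => markAccept (v 0) (t v) A := by
  classical
  exact .set 6 ht (.ite (.ex fun _ _ _ hy => .and (.and (.lt hy (.read 7 (.input 0)))
    (.ne_zero (.read 2 hy))) (compP_acceptingA hy)) (.const 1) (.const 0))

theorem compT_decideAll : CompT n fun v A => decideAll (v 0) A :=
  .iter (H := fun v t A => decidePair (v 0) t A) fun _ _ t ht =>
    .seq (T := fun v A => iter (column (v 0) (t v)) (v 0) (markStart (v 0) A))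
      (U := fun v A => markAccept (v 0) (t v) A)
      (.seq (T := fun v A => markStart (v 0) A) (U := fun v A => iter (column (v 0) (t v)) (v 0) A)
        compT_markStart (.iter (H := fun v => column (v 0) (t v)) fun _ hm _ hj =>
          .ite (.lt hj (.input 1)) (compT_advance (ht.mono hm) hj) .skip))
      (compT_markAccept ht)

theorem comp_maxStatesA : Comp n fun v A => maxStatesA (v 0) A :=
  .find fun _ _ _ hs => .all fun _ hm _ hi =>
    .imp (.lt hi (.input 0)) (.le (comp_statesA hi) (hs.mono hm))

theorem compT_fillOffsets : CompT n fun v A => fillOffsets (v 0) A :=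
  .seq (T := fun _ A => setCell A 1 0 3)
    (U := fun v A => iter (fun i A => setCell A 1 (i + 1)
      (A 1 i + (2 + statesA A i + mulB (v 0) (A 0 2) (statesA A i)))) (v 0) A)
    (.set 1 (.const 0) (.const 3))
    (.iter (H := fun v i A => setCell A 1 (i + 1)
      (A 1 i + (2 + statesA A i + mulB (v 0) (A 0 2) (statesA A i)))) fun _ _ _ hi =>
      .set 1 (.add hi (.const 1)) (.add (.read 1 hi) (.add (.add (.const 2) (comp_statesA hi))
        (.mul (.input 2) (comp_statesA hi)))))

theorem compT_fillPowers : CompT n fun v A => fillPowers (v 0) A :=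
  .seq (T := fun _ A => setCell A 7 0 1)
    (U := fun v A => iter (fun i A => setCell A 7 (i + 1)
      (mulB (v 0) (A 7 i) (maxStatesA (v 0) A))) (v 0) A)
    (.set 7 (.const 0) (.const 1))
    (.iter (H := fun v i A => setCell A 7 (i + 1) (mulB (v 0) (A 7 i) (maxStatesA (v 0) A)))
      fun _ _ _ hi => .set 7 (.add hi (.const 1)) (.mul (.read 7 hi) comp_maxStatesA))

theorem comp_loopBound : Comp n fun v A => loopBound (v 0) A :=
  .mul (.mul (.mul (.mul (.read 7 (.input 0)) .bound) .bound) .bound) .bound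

end Ram

/-! ### Correctness of the array program -/

namespace RegularGcc

variable (I : RegularGcc)

/-- The instance has rows, columns and values, and `B` is large enough for all loops. -/
structure Fits (B : ℕ) : Prop where
  rows_pos : 0 < I.rows
  cols_pos : 0 < I.cols
  vals_pos : 0 < I.vals
  rows_le : I.rows ≤ B
  size_le : I.rows * I.cols * I.vals ≤ B
  cells_le : I.cols * I.vals ≤ B
  codes_le : I.maxStates ^ I.rows ≤ B
  auction_lt : I.vals * I.rows * (I.vals * I.rows + 1) < B

/-- The arrays `0`, `1` and `7` hold the instance, the positions of the automata and the powers of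
the maximal number of states. -/
structure Loaded (A : Ram.Arr) : Prop where
  cell : A 0 = I.cell
  offset : ∀ i ≤ I.rows, A 1 i = I.offset i
  power : ∀ i ≤ I.rows, A 7 i = I.maxStates ^ i

variable {I} {B : ℕ} {A A' : Ram.Arr}

theorem Loaded.congr (h : I.Loaded A) (h0 : A' 0 = A 0) (h1 : A' 1 = A 1) (h7 : A' 7 = A 7) :
    I.Loaded A' :=
  ⟨h0.trans h.cell, fun i hi => by rw [h1, h.offset i hi], fun i hi => by rw [h7, h.power i hi]⟩

theorem Fits.cols_le (hB : I.Fits B) : I.cols ≤ B :=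
  (Nat.le_mul_of_pos_right _ hB.vals_pos).trans hB.cells_le

theorem Fits.vals_le (hB : I.Fits B) : I.vals ≤ B :=
  (Nat.le_mul_of_pos_left _ hB.cols_pos).trans hB.cells_le

theorem maxStates_pos (h : 0 < I.rows) : 0 < I.maxStates :=
  (Nat.zero_le _).trans_lt (((I.aut ⟨0, h⟩).start).2.trans_le (I.states_le_maxStates ⟨0, h⟩))

/-- The quotients involved are at most `a ≤ B`, so the truncated arithmetic is exact. -/
theorem Fits.digitA_eq (hB : I.Fits B) (h : I.Loaded A) {a : ℕ} (ha : a < I.maxStates ^ I.rows)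
    {i : ℕ} (hi : i < I.rows) : Ram.digitA B A a i = digit I.maxStates a i := by
  have hQ := I.maxStates_pos hB.rows_pos
  have haB : a ≤ B := ha.le.trans hB.codes_le
  have h1 : a / I.maxStates ^ i ≤ B := (Nat.div_le_self _ _).trans haB
  rw [Ram.digitA, h.power i hi.le, h.power 1 hB.rows_pos, pow_one, Ram.divB_eq (pow_pos hQ _) h1,
    Ram.modB_eq hQ ((Nat.div_le_self _ _).trans h1), digit]

theorem Loaded.statesA_eq (h : I.Loaded A) {i : ℕ} (hi : i < I.rows) :
    Ram.statesA A i = I.states ⟨i, hi⟩ := by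
  rw [Ram.statesA, h.offset i hi.le, h.cell]
  exact I.cell_states ⟨i, hi⟩

theorem Fits.stepA_eq (hB : I.Fits B) (h : I.Loaded A) {i s v : ℕ} (hi : i < I.rows)
    (hs : s < I.states ⟨i, hi⟩) (hv : v < I.vals) :
    Ram.stepA B A i s v = (I.aut ⟨i, hi⟩).step ⟨s, hs⟩ ⟨v, hv⟩ := by
  rw [Ram.stepA, h.statesA_eq hi, h.offset i hi.le, h.cell, I.cell_two, Ram.mulB_eq hB.vals_le]
  exact I.cell_step ⟨i, hi⟩ ⟨s, hs⟩ ⟨v, hv⟩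

theorem Fits.baseA_eq (hB : I.Fits B) (h : I.Loaded A) (i j : ℕ) :
    Ram.baseA B A i j = (i * I.cols + j) * I.vals := by
  rw [Ram.baseA, h.cell, I.cell_one, I.cell_two, Ram.mulB_eq hB.cols_le, Ram.mulB_eq hB.vals_le]

theorem Fits.sizeA_eq (hB : I.Fits B) (h : I.Loaded A) :
    Ram.sizeA B A = I.rows * I.cols * I.vals := by
  rw [Ram.sizeA, h.cell, I.cell_zero, I.cell_one, I.cell_two, Ram.mulB_eq hB.cols_le,
    Ram.mulB_eq hB.vals_le]

theorem Fits.lowerA_eq (hB : I.Fits B) (h : I.Loaded A) (j : Fin I.cols) {v : ℕ}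
    (hv : v < I.vals) : Ram.lowerA B A j v = I.lowerAt j v := by
  rw [Ram.lowerA, hB.sizeA_eq h, h.cell, I.cell_zero, I.cell_two, h.offset _ le_rfl,
    Ram.mulB_eq hB.vals_le, lowerAt, dif_pos hv]
  exact I.cell_lower j ⟨v, hv⟩

theorem Fits.upperA_eq (hB : I.Fits B) (h : I.Loaded A) (j : Fin I.cols) {v : ℕ}
    (hv : v < I.vals) : Ram.upperA B A j v = I.upperAt j v := by
  rw [Ram.upperA, hB.sizeA_eq h, h.cell, I.cell_zero, I.cell_one, I.cell_two, h.offset _ le_rfl,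
    Ram.mulB_eq hB.vals_le, Ram.mulB_eq hB.vals_le, upperAt, dif_pos hv]
  exact I.cell_upper j ⟨v, hv⟩

theorem Fits.rowStepA_iff (hB : I.Fits B) (h : I.Loaded A) {t a b i v : ℕ} (j : Fin I.cols)
    (ha : a < I.maxStates ^ I.rows) (hb : b < I.maxStates ^ I.rows) (hi : i < I.rows)
    (hv : v < I.vals) :
    Ram.RowStepA B A t j a b i v ↔ I.rowStep (I.forced t) j a b i v := by
  have hdom := I.cell_dom ⟨i, hi⟩ j ⟨v, hv⟩
  simp only at hdom
  rw [Ram.RowStepA, rowStep, hB.baseA_eq h, hB.digitA_eq h ha hi, hB.digitA_eq h hb hi,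
    h.statesA_eq hi, h.cell, I.cell_zero, I.cell_two, h.offset _ le_rfl, hdom]
  constructor
  · rintro ⟨⟨h1, h2⟩, h3, h4⟩
    rw [hB.stepA_eq h hi h3 hv] at h4
    exact ⟨hi, hv, Finset.mem_filter.2 ⟨h1, h2⟩, h3, h4⟩
  · rintro ⟨_, _, h1, h3, h4⟩
    rw [← hB.stepA_eq h hi h3 hv] at h4
    exact ⟨Finset.mem_filter.1 h1, h3, h4⟩

theorem Fits.slotRelA_iff (hB : I.Fits B) (h : I.Loaded A) {t a b i z : ℕ} (j : Fin I.cols)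
    (ha : a < I.maxStates ^ I.rows) (hb : b < I.maxStates ^ I.rows) :
    Ram.SlotRelA B A t j a b i z ↔ slotRel I.rows I.vals (I.rowStep (I.forced t) j a b)
      (I.lowerAt j) (I.upperAt j) i z := by
  rw [Ram.SlotRelA, slotRel]
  simp only [h.cell, I.cell_zero, I.cell_two, Ram.mulB_eq hB.rows_le]
  constructor
  · rintro ⟨v, -, hv, c, -, hc, hz, hcase⟩
    rw [hB.upperA_eq h j hv, hB.lowerA_eq h j hv] at hcase
    refine ⟨v, hv, c, hc, hz, hcase.imp_left fun ⟨h1, h2, h3⟩ => ⟨h1, ?_, h3⟩⟩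
    exact (hB.rowStepA_iff h j ha hb h1 hv).1 h2
  · rintro ⟨v, hv, c, hc, hz, hcase⟩
    refine ⟨v, hv.trans_le hB.vals_le, hv, c, hc.trans_le hB.rows_le, hc, hz, ?_⟩
    rw [hB.upperA_eq h j hv, hB.lowerA_eq h j hv]
    exact hcase.imp_left fun ⟨h1, h2, h3⟩ => ⟨h1, (hB.rowStepA_iff h j ha hb h1 hv).2 h2, h3⟩

/-- The arrays other than `3`, `4` and `5` agree. -/
def SameMarks (A A' : Ram.Arr) : Prop := ∀ k, k ≠ 3 → k ≠ 4 → k ≠ 5 → A' k = A k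

theorem SameMarks.trans {A'' : Ram.Arr} (h : SameMarks A A') (h' : SameMarks A' A'') :
    SameMarks A A'' := fun k h3 h4 h5 => (h' k h3 h4 h5).trans (h k h3 h4 h5)

theorem SameMarks.loaded (h : SameMarks A A') (hA : I.Loaded A) : I.Loaded A' :=
  hA.congr (h 0 (by decide) (by decide) (by decide)) (h 1 (by decide) (by decide) (by decide))
    (h 7 (by decide) (by decide) (by decide))

/-- The auction writes only prices and owners, so its relation stays the same throughout, and
success together with the test of the lower bounds means `GccSolvable`. All cells of the array `3`
are described since marks accumulate over many transitions. -/
theorem Fits.transition_spec (hB : I.Fits B) (h : I.Loaded A) {t a b : ℕ} (j : Fin I.cols) :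
    SameMarks A (Ram.transition B t j a b A) ∧
      ∀ b', Ram.transition B t j a b A 3 b' ≠ 0 ↔ A 3 b' ≠ 0 ∨ b' = b ∧
        (a < I.maxStates ^ I.rows ∧ b < I.maxStates ^ I.rows) ∧ A 2 a ≠ 0 ∧
          I.colStep (I.forced t) j a b := by
  have hQ : A 7 (A 0 0) = I.maxStates ^ I.rows := by
    rw [h.cell, I.cell_zero, h.power _ le_rfl]
  rw [Ram.transition, hQ]
  split_ifs with hc
  swap
  · refine ⟨fun _ _ _ _ => rfl, fun b' => ⟨.inl, ?_⟩⟩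
    rintro (h1 | ⟨-, h1, h2, -⟩)
    · exact h1
    · exact absurd ⟨h1, h2⟩ hc
  obtain ⟨⟨ha, hb⟩, hm⟩ := hc
  have hP : Ram.slotsA B A = I.vals * I.rows := by
    rw [Ram.slotsA, h.cell, I.cell_zero, I.cell_two, Ram.mulB_eq hB.rows_le]
  have hload : ∀ A', Ram.SameData A A' → I.Loaded A' := fun A' hA' =>
    h.congr (hA' 0 (by decide) (by decide)) (hA' 1 (by decide) (by decide))
      (hA' 7 (by decide) (by decide))
  obtain ⟨s1, s2⟩ := Ram.auction_spec (B := B) (A := A) (P := I.vals * I.rows)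
    (Pf := Ram.slotsA B) (alf := fun A => Ram.SlotRelA B A t j a b)
    (al := slotRel I.rows I.vals (I.rowStep (I.forced t) j a b) (I.lowerAt j) (I.upperAt j))
    (fun A' hA' => by
      have hl := hload A' hA'
      refine ⟨?_, ?_⟩
      · rw [Ram.slotsA, hl.cell, I.cell_zero, I.cell_two, Ram.mulB_eq hB.rows_le]
      · funext i z
        exact propext (hB.slotRelA_iff hl j ha hb)) hB.auction_lt
  set A1 := Ram.auction B (Ram.slotsA B) (fun A => Ram.SlotRelA B A t j a b) A with hA1
  have hl := hload A1 s1
  have hP1 : Ram.slotsA B A1 = I.vals * I.rows := by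
    rw [Ram.slotsA, hl.cell, I.cell_zero, I.cell_two, Ram.mulB_eq hB.rows_le]
  have hiff : ((∀ v < B, v < A1 0 2 → Ram.lowerA B A1 j v ≤ A1 0 0) ∧
      Ram.AuctionSuccess B (Ram.slotsA B A1) A1) ↔ I.colStep (I.forced t) j a b := by
    rw [hP1, s2, colStep, ← hasMatching_iff_gccSolvable hB.vals_pos]
    refine and_congr_left fun _ => ?_
    rw [hl.cell, I.cell_zero, I.cell_two]
    constructor
    · intro hh v hv
      rw [← hB.lowerA_eq hl j hv]
      exact hh v (hv.trans_le hB.vals_le) hv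
    · intro hh v _ hv
      rw [hB.lowerA_eq hl j hv]
      exact hh v hv
  have hs1 : SameMarks A A1 := fun k _ h4 h5 => s1 k h4 h5
  have h3 : A1 3 = A 3 := s1 3 (by decide) (by decide)
  rw [Ram.columnAuction, ← hA1, Ram.markSuccess]
  by_cases hcol : I.colStep (I.forced t) j a b
  · rw [if_pos (hiff.2 hcol)]
    refine ⟨fun k h3 h4 h5 => ?_, fun b' => ?_⟩
    · rw [Ram.setCell_of_ne _ _ _ h3, hs1 k h3 h4 h5]
    · rw [Ram.setCell_same, h3]
      by_cases e : b' = b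
      · subst e
        simp [ha, hb, hm, hcol]
      · simp [e]
  · rw [if_neg fun hh => hcol (hiff.1 hh)]
    refine ⟨hs1, fun b' => ?_⟩
    rw [h3]
    tauto

/-- The codes reached before column `j` must stay readable while the new ones are collected, hence
the two arrays `2` and `3`; the former is overwritten only at the end. -/
theorem Fits.advance_spec (hB : I.Fits B) (h : I.Loaded A) {t : ℕ} (j : Fin I.cols)
    (hA : ∀ a < I.maxStates ^ I.rows, A 2 a ≠ 0 ↔ I.Reach (I.forced t) j a) :
    (∀ k, k ≠ 2 → k ≠ 3 → k ≠ 4 → k ≠ 5 → Ram.advance B t j A k = A k) ∧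
      ∀ b < I.maxStates ^ I.rows,
        Ram.advance B t j A 2 b ≠ 0 ↔ I.Reach (I.forced t) (j + 1) b := by
  have h1 := Ram.iter_inv (H := fun b A => Ram.setCell A 3 b 0) (B := B) (A := A)
    (fun t A' => SameMarks A A' ∧ ∀ b < t, A' 3 b = 0) ⟨fun _ _ _ _ => rfl, by simp⟩ (by
      rintro i - A' ⟨h1, h2⟩
      refine ⟨fun k h3 h4 h5 => ?_, fun b hb => ?_⟩
      · rw [Ram.setCell_of_ne _ _ _ h3, h1 k h3 h4 h5]
      · rw [Ram.setCell_same]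
        by_cases e : b = i
        · simp [e]
        · rw [Function.update_of_ne e]
          exact h2 b (by omega))
  obtain ⟨h1, h2⟩ := h1
  rw [Ram.advance]
  set A1 := Ram.iter (fun b A => Ram.setCell A 3 b 0) B A
  have h3 := Ram.iter_inv (B := B) (A := A1)
    (H := fun a A => Ram.iter (fun b A => Ram.transition B t j a b A) B A)
    (fun s A' => SameMarks A A' ∧ ∀ b < I.maxStates ^ I.rows, A' 3 b ≠ 0 ↔
      ∃ a < s, a < I.maxStates ^ I.rows ∧ A 2 a ≠ 0 ∧ I.colStep (I.forced t) j a b)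
    ⟨h1, fun b hb => by simp [h2 b (hb.trans_le hB.codes_le)]⟩ (by
      rintro a - A' ⟨k1, k2⟩
      have k3 := Ram.iter_inv (B := B) (A := A') (H := fun b A => Ram.transition B t j a b A)
        (fun s A'' => SameMarks A' A'' ∧ ∀ b < I.maxStates ^ I.rows, A'' 3 b ≠ 0 ↔ A' 3 b ≠ 0 ∨
          b < s ∧ a < I.maxStates ^ I.rows ∧ A 2 a ≠ 0 ∧ I.colStep (I.forced t) j a b)
        ⟨fun _ _ _ _ => rfl, by simp⟩ (by
          rintro b - A'' ⟨l1, l2⟩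
          have l3 := k1.trans l1
          obtain ⟨l4, l5⟩ := hB.transition_spec (l3.loaded h) (t := t) (a := a) (b := b) j
          refine ⟨l1.trans l4, fun b' hb' => ?_⟩
          rw [l5, l2 b' hb', l3 2 (by decide) (by decide) (by decide)]
          by_cases e : b' = b
          · subst e
            simp only [hb', and_true, true_and, lt_irrefl, false_and, or_false, Nat.lt_succ_self]
          · have : b' < b + 1 ↔ b' < b := by omega
            simp [e, this])
      obtain ⟨k3, k4⟩ := k3
      refine ⟨k1.trans k3, fun b hb => ?_⟩
      rw [k4 b hb, k2 b hb]
      constructor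
      · rintro (⟨a', ha', hh⟩ | ⟨-, hh⟩)
        · exact ⟨a', by omega, hh⟩
        · exact ⟨a, by omega, hh⟩
      · rintro ⟨a', ha', hh⟩
        by_cases e : a' = a
        · subst e
          exact .inr ⟨hb.trans_le hB.codes_le, hh⟩
        · exact .inl ⟨a', by omega, hh⟩)
  obtain ⟨h3, h4⟩ := h3
  set A2 := Ram.iter (fun a A => Ram.iter (fun b A => Ram.transition B t j a b A) B A) B A1
  have h5 := Ram.iter_inv (H := fun b A => Ram.setCell A 2 b (A 3 b)) (B := B) (A := A2)
    (fun t A' => (∀ k, k ≠ 2 → A' k = A2 k) ∧ ∀ b < t, A' 2 b = A2 3 b) ⟨fun _ _ => rfl, by simp⟩ (by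
      rintro i - A' ⟨h1, h2⟩
      refine ⟨fun k hk => ?_, fun b hb => ?_⟩
      · rw [Ram.setCell_of_ne _ _ _ hk, h1 k hk]
      · rw [Ram.setCell_same]
        by_cases e : b = i
        · simp [e, h1]
        · rw [Function.update_of_ne e]
          exact h2 b (by omega))
  obtain ⟨h5, h6⟩ := h5
  refine ⟨fun k k2 k3 k4 k5 => by rw [h5 k k2, h3 k k3 k4 k5], fun b hb => ?_⟩
  rw [h6 b (hb.trans_le hB.codes_le), h4 b hb, Reach]
  constructor
  · rintro ⟨a, -, ha, hm, hs⟩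
    exact ⟨a, ha, (hA a ha).1 hm, j.2, hs⟩
  · rintro ⟨a, ha, hr, _, hs⟩
    exact ⟨a, ha.trans_le hB.codes_le, ha, (hA a ha).2 hr, hs⟩

theorem Fits.markStart_spec (hB : I.Fits B) (h : I.Loaded A) (D : I.Domains) :
    (∀ k, k ≠ 2 → Ram.markStart B A k = A k) ∧
      ∀ a < I.maxStates ^ I.rows, Ram.markStart B A 2 a ≠ 0 ↔ I.Reach D 0 a := by
  have key : (∀ k, k ≠ 2 → Ram.markStart B A k = A k) ∧ ∀ a < B, a < I.maxStates ^ I.rows →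
      (Ram.markStart B A 2 a ≠ 0 ↔ I.Reach D 0 a) := by
    unfold Ram.markStart
    refine Ram.iter_inv (fun t A' => (∀ k, k ≠ 2 → A' k = A k) ∧ ∀ a < t,
      a < I.maxStates ^ I.rows → (A' 2 a ≠ 0 ↔ I.Reach D 0 a)) ⟨fun _ _ => rfl, by simp⟩ ?_
    rintro a - A' ⟨h1, h2⟩
    refine ⟨fun k hk => ?_, fun a' ha' ha2 => ?_⟩
    · rw [Ram.setCell_of_ne _ _ _ hk, h1 k hk]
    · rw [Ram.setCell_same]
      by_cases e : a' = a
      · subst e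
        have hl : I.Loaded A' := h.congr (h1 0 (by decide)) (h1 1 (by decide)) (h1 7 (by decide))
        rw [Function.update_self, Reach]
        have : (∀ i < B, i < A' 0 0 → Ram.digitA B A' a' i = A' 0 (A' 1 i + 1)) ↔
            ∀ i : Fin I.rows, digit I.maxStates a' i = (I.aut i).start := by
          rw [hl.cell, I.cell_zero]
          constructor
          · intro hh i
            have := hh i (i.2.trans_le hB.rows_le) i.2
            rwa [hB.digitA_eq hl ha2 i.2, hl.offset _ i.2.le, I.cell_start] at this
          · intro hh i _ hi
            rw [hB.digitA_eq hl ha2 hi, hl.offset _ hi.le, hh ⟨i, hi⟩]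
            exact (I.cell_start ⟨i, hi⟩).symm
        by_cases hc : ∀ i : Fin I.rows, digit I.maxStates a' i = (I.aut i).start
        · rw [if_pos (this.2 hc)]; simp [hc]
        · rw [if_neg fun hh => hc (this.1 hh)]; simp [hc]
      · rw [Function.update_of_ne e]
        exact h2 a' (by omega) ha2
  exact ⟨key.1, fun a ha => key.2 a (ha.trans_le hB.codes_le) ha⟩

theorem Fits.decidePair_spec (hB : I.Fits B) (h : I.Loaded A) (t : ℕ) :
    I.Loaded (Ram.decidePair B t A) ∧ (∀ t', t' ≠ t → Ram.decidePair B t A 6 t' = A 6 t') ∧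
      Ram.decidePair B t A 6 t =
        @ite _ (∃ M, I.IsSolution (I.forced t) M) (Classical.propDecidable _) 1 0 := by
  obtain ⟨h1, h2⟩ := hB.markStart_spec h (I.forced t)
  rw [Ram.decidePair]
  set A1 := Ram.markStart B A
  -- The loop runs `B` times, but rounds beyond the last column are idle; therefore the invariant
  -- speaks of `min j I.cols`.
  have h3 := Ram.iter_inv (H := Ram.column B t) (B := B) (A := A1)
    (fun j A' => (∀ k, k ≠ 2 → k ≠ 3 → k ≠ 4 → k ≠ 5 → A' k = A k) ∧
      ∀ a < I.maxStates ^ I.rows, A' 2 a ≠ 0 ↔ I.Reach (I.forced t) (min j I.cols) a)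
    ⟨fun k hk _ _ _ => h1 k hk, fun a ha => by simpa using h2 a ha⟩ (by
      rintro j - A' ⟨k1, k2⟩
      have hl : I.Loaded A' := h.congr (k1 0 (by decide) (by decide) (by decide) (by decide))
        (k1 1 (by decide) (by decide) (by decide) (by decide))
        (k1 7 (by decide) (by decide) (by decide) (by decide))
      rw [Ram.column, hl.cell, I.cell_one]
      split_ifs with hj
      · rw [min_eq_left hj.le] at k2
        rw [min_eq_left (Nat.succ_le_of_lt hj)]
        obtain ⟨k3, k4⟩ := hB.advance_spec hl ⟨j, hj⟩ k2
        exact ⟨fun k a b c d => by rw [← k1 k a b c d]; exact k3 k a b c d, k4⟩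
      · rw [min_eq_right (by omega)] at k2 ⊢
        exact ⟨k1, k2⟩)
  obtain ⟨h3, h4⟩ := h3
  set A2 := Ram.iter (Ram.column B t) B A1
  have hl : I.Loaded A2 := h.congr (h3 0 (by decide) (by decide) (by decide) (by decide))
    (h3 1 (by decide) (by decide) (by decide) (by decide))
    (h3 7 (by decide) (by decide) (by decide) (by decide))
  rw [min_eq_right hB.cols_le] at h4
  rw [Ram.markAccept]
  refine ⟨hl.congr ?_ ?_ ?_, fun t' ht' => ?_, ?_⟩
  · exact Ram.setCell_of_ne _ _ _ (by decide)
  · exact Ram.setCell_of_ne _ _ _ (by decide)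
  · exact Ram.setCell_of_ne _ _ _ (by decide)
  · rw [Ram.setCell_same, Function.update_of_ne ht',
      h3 6 (by decide) (by decide) (by decide) (by decide)]
  · rw [Ram.setCell_same, Function.update_self]
    have hacc : ∀ a < I.maxStates ^ I.rows, (Ram.AcceptingA B A2 a ↔ I.Accepting a) := by
      intro a ha
      rw [Ram.AcceptingA, Accepting, hl.cell, I.cell_zero]
      have : ∀ (i : ℕ) (hi : i < I.rows), (Ram.digitA B A2 a i < Ram.statesA A2 i ∧
          I.cell (A2 1 i + (2 + Ram.digitA B A2 a i)) ≠ 0) ↔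
          ∃ h : digit I.maxStates a i < I.states ⟨i, hi⟩, ⟨_, h⟩ ∈ (I.aut ⟨i, hi⟩).accept := by
        intro i hi
        rw [hB.digitA_eq hl ha hi, hl.statesA_eq hi, hl.offset i hi.le, ← exists_prop]
        exact exists_congr fun hd => I.cell_accept ⟨i, hi⟩ ⟨_, hd⟩
      exact ⟨fun hh i => (this i i.2).1 (hh i (i.2.trans_le hB.rows_le) i.2),
        fun hh i _ hi => (this i hi).2 (hh ⟨i, hi⟩)⟩
    have : (∃ a < B, (a < A2 7 (A2 0 0) ∧ A2 2 a ≠ 0) ∧ Ram.AcceptingA B A2 a) ↔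
        ∃ M, I.IsSolution (I.forced t) M := by
      rw [I.exists_isSolution_iff hB.vals_pos, hl.cell, I.cell_zero, hl.power _ le_rfl]
      constructor
      · rintro ⟨a, -, ⟨ha, hm⟩, hh⟩
        exact ⟨a, ha, (h4 a ha).1 hm, (hacc a ha).1 hh⟩
      · rintro ⟨a, ha, hm, hh⟩
        exact ⟨a, ha.trans_le hB.codes_le, ⟨ha, (h4 a ha).2 hm⟩, (hacc a ha).2 hh⟩
    by_cases hc : ∃ M, I.IsSolution (I.forced t) M
    · rw [if_pos hc, if_pos (this.2 hc)]
    · rw [if_neg hc, if_neg fun hh => hc (this.1 hh)]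

theorem Fits.decideAll_spec (hB : I.Fits B) (h : I.Loaded A) :
    I.Loaded (Ram.decideAll B A) ∧ ∀ t < B, Ram.decideAll B A 6 t =
      @ite _ (∃ M, I.IsSolution (I.forced t) M) (Classical.propDecidable _) 1 0 := by
  refine Ram.iter_inv (fun t A' => I.Loaded A' ∧ ∀ t' < t, A' 6 t' =
      @ite _ (∃ M, I.IsSolution (I.forced t') M) (Classical.propDecidable _) 1 0)
    ⟨h, by simp⟩ ?_
  rintro t - A' ⟨h1, h2⟩
  obtain ⟨h3, h4, h5⟩ := hB.decidePair_spec h1 t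
  refine ⟨h3, fun t' ht' => ?_⟩
  by_cases e : t' = t
  · subst e
    exact h5
  · rw [h4 t' e, h2 t' (by omega)]

theorem Fits.encodeDomains_eq (hB : I.Fits B) (h : I.Loaded A) :
    I.encodeDomains I.consistentDomains =
      (List.range (I.rows * I.cols * I.vals)).map (Ram.decideAll B A 6) := by
  obtain ⟨-, hd⟩ := hB.decideAll_spec h
  refine List.ext_getElem (by simp [length_encodeDomains]) fun t h1 h2 => ?_
  have ht : t < I.rows * I.cols * I.vals := by rwa [length_encodeDomains] at h1
  rw [List.getElem_map, List.getElem_range, hd t (ht.trans_le hB.size_le)]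
  -- The number `t` is decoded in mixed radix into row, column and value.
  set v : Fin I.vals := ⟨t % I.vals, Nat.mod_lt _ hB.vals_pos⟩ with hv
  set j : Fin I.cols := ⟨t / I.vals % I.cols, Nat.mod_lt _ hB.cols_pos⟩ with hj
  set i : Fin I.rows := ⟨t / I.vals / I.cols, by
    rw [Nat.div_lt_iff_lt_mul hB.cols_pos, Nat.div_lt_iff_lt_mul hB.vals_pos]
    exact ht⟩ with hi
  have e : (i * I.cols + j) * I.vals + v = t := by
    simp only [hi, hj, hv]
    rw [Nat.div_add_mod', Nat.div_add_mod']
  have := (I.getD_encodeDomains I.consistentDomains i j v).2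
  rw [e, List.getD_eq_getElem _ _ h1] at this
  rw [this]
  have hf := fun M => I.isSolution_forced_iff i j v M
  rw [e] at hf
  have hiff : v ∈ I.consistentDomains i j ↔ ∃ M, I.IsSolution (I.forced t) M :=
    I.mem_consistentDomains.trans (exists_congr fun M => (hf M).symm)
  by_cases hc : ∃ M, I.IsSolution (I.forced t) M
  · rw [if_pos hc, if_pos (hiff.2 hc)]
  · rw [if_neg hc, if_neg fun hh => hc (hiff.1 hh)]

end RegularGcc

namespace Ram

/-! ### Input and output -/

/-- The arrays holding the input `x` in the array `0`. -/
def inputArr (x : List ℕ) : Arr := fun k i => if k = 0 then x.getD i 0 else 0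

/-- Move the input to the array `0`. -/
def relocate : Prog :=
  ops [.copy 1 0] (.loop 1 (ops [.const 2 1, .sub 1 1 2, .load 3 1, .const 2 0, .store 1 2,
    .add 2 1 1, .add 2 2 2, .add 2 2 2] (.op (.store 2 3))))

/-- Cells are moved from the last to the first: as `m ≤ 8 * m`, a target never holds a cell still to
be read. The old cell is cleared before the new one is written, which matters for `m = 0`, where the
two coincide. -/
theorem runs_relocate (x : List ℕ) : Runs relocate (init x) (10 * x.length + 2) fun s =>
    s.mem = flat (inputArr x) ∧ s.out = [] ∧ s.reg 0 = x.length := by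
  have key := Runs.ops (l := [.copy 1 0]) (s := init x) (Runs.loop (c := 1) (N := x.length) (K := 9)
    (P := ops [.const 2 1, .sub 1 1 2, .load 3 1, .const 2 0, .store 1 2,
      .add 2 1 1, .add 2 2 2, .add 2 2 2] (.op (.store 2 3)))
    (fun i s => s.out = [] ∧ s.reg 0 = x.length ∧ ∀ a, s.mem a =
      if a < x.length - i then x.getD a 0 else
        if a % 8 = 0 ∧ x.length - i ≤ a / 8 then x.getD (a / 8) 0 else 0)
    (s := List.foldl (fun s (o : Op) => o.apply s) (init x) [.copy 1 0]) ?_ ?_ ?_)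
  · refine key.mono (by simp; omega) fun s ⟨h1, h2, h3⟩ => ⟨?_, h1, h2⟩
    funext a
    rw [h3]
    by_cases ha : a % 8 = 0 <;> simp [flat, inputArr, ha]
  · rintro i s hi ⟨h1, h2, h3⟩ hc
    refine (Runs.ops (l := [.const 2 1, .sub 1 1 2, .load 3 1, .const 2 0, .store 1 2,
      .add 2 1 1, .add 2 2 2, .add 2 2 2]) (.op ?_)).mono (by simp) fun _ h => h
    refine ⟨⟨by simpa [Op.apply] using h1, by simpa [Op.apply] using h2, fun a => ?_⟩, ?_⟩
    · obtain ⟨m, hm⟩ : ∃ m, x.length - i = m + 1 := ⟨x.length - i - 1, by omega⟩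
      have hm' : x.length - (i + 1) = m := by omega
      rw [hm] at hc
      rw [hm']
      simp only [hm] at h3
      simp [Op.apply, hc, Function.update_apply, h3]
      have e8 : m + m + (m + m) + (m + m + (m + m)) = 8 * m := by omega
      rw [e8]
      by_cases ha : a = 8 * m
      · subst ha
        have : ¬ 8 * m < m := by omega
        simp [this]
      · by_cases ha' : a = m
        · subst ha'
          have : ¬ a ≤ a / 8 := by omega
          simp [ha, this]
        · rw [if_neg ha, if_neg ha']
          split_ifs <;> first | rfl | omega
    · simp [Op.apply, hc]
      omega
  · refine ⟨rfl, rfl, fun a => ?_⟩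
    simp only [List.foldl, Op.apply, init, Nat.sub_zero]
    split_ifs with h1 h2
    · rfl
    · rw [List.getD_eq_default _ _ (by omega), List.getD_eq_default _ _ (by omega)]
    · rw [List.getD_eq_default _ _ (by omega)]
  · rfl

/-- Write the first cells of the array `6`, their number being in register `1`. -/
def emit : Prog :=
  ops [.copy 2 0] (.loop 2 (ops [.sub 3 0 2, .sub 4 1 3] (.seq (.branch 4
    (ops [.add 4 3 3, .add 4 4 4, .add 4 4 4, .const 5 6, .add 4 4 5, .load 4 4] (.op (.write 4)))
    (.op (.const 4 0))) (ops [.const 4 1] (.op (.sub 2 2 4))))))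

/-- The number of rounds is register `0`, so the time is bounded whatever register `1` contains; the
latter only filters the output. -/
theorem runs_emit {s : State} {A : Arr} (hs : s.mem = flat A) (ho : s.out = []) :
    Runs emit s (13 * s.reg 0 + 2) fun s' => s'.out =
      ((List.range (s.reg 0)).filter fun t => t < s.reg 1).map (A 6) := by
  have key := Runs.ops (l := [.copy 2 0]) (s := s) (Runs.loop (c := 2) (N := s.reg 0) (K := 12)
    (P := ops [.sub 3 0 2, .sub 4 1 3] (.seq (.branch 4
      (ops [.add 4 3 3, .add 4 4 4, .add 4 4 4, .const 5 6, .add 4 4 5, .load 4 4] (.op (.write 4)))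
      (.op (.const 4 0))) (ops [.const 4 1] (.op (.sub 2 2 4)))))
    (fun i s' => s'.mem = flat A ∧ s'.reg 0 = s.reg 0 ∧ s'.reg 1 = s.reg 1 ∧
      s'.out = ((List.range i).filter fun t => t < s.reg 1).map (A 6))
    (s := List.foldl (fun s (o : Op) => o.apply s) s [.copy 2 0]) ?_ ?_ ?_)
  · exact key.mono (by simp; omega) fun s' h => h.2.2.2
  · rintro i s' hi ⟨h1, h2, h3, h4⟩ hc
    have e : s.reg 0 - (s.reg 0 - i) = i := by omega
    refine (Runs.ops (l := [.sub 3 0 2, .sub 4 1 3]) (.seq (.branch (K := 7) (fun h => ?_) fun h => ?_))).mono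
      (L := 12) (K := 2 + (8 + 2)) (by simp) fun _ h => h
    · simp [Op.apply, h2, h3, hc, e] at h
      refine (Runs.ops (.op ?_)).mono (by simp) fun _ h => h
      refine (Runs.ops (l := [_]) (.op ?_))
      have e8 : i + i + (i + i) + (i + i + (i + i)) + 6 = 8 * i + ((6 : Fin 8) : ℕ) := by
        simp; omega
      have hr : s'.mem (i + i + (i + i) + (i + i + (i + i)) + 6) = A 6 i := by
        rw [h1, e8, flat_apply]
      simp [Op.apply, h1, h2, h3, h4, hc, e, List.range_succ]
      rw [← h1, hr]
      have hf : List.filter (fun t => decide (t < s.reg 1)) [i] = [i] := by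
        rw [List.filter_singleton, decide_eq_true (by omega)]
        rfl
      rw [hf]
      exact ⟨rfl, by omega⟩
    · simp [Op.apply, h2, h3, hc, e] at h
      refine (Runs.op ?_).mono (by simp) fun _ h => h
      refine (Runs.ops (l := [_]) (.op ?_))
      have : ¬ i < s.reg 1 := by omega
      simp [Op.apply, h1, h2, h3, h4, hc, List.range_succ, this]
      omega
  · simp [Op.apply, hs, ho]
  · simp [Op.apply]

end Ram

/-! ### Preparation of the arrays -/

namespace RegularGcc

variable (I : RegularGcc)

theorem inputArr_cell : Ram.inputArr I.encode 0 = I.cell := by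
  funext m
  simp [Ram.inputArr, cell]

theorem maxStates_lt_length : I.maxStates < I.encode.length :=
  (Finset.sup_lt_iff (by
    have := I.rows_lt_length
    exact (Nat.zero_le _).trans_lt this)).2 fun i _ => I.states_lt_length i

theorem fillOffsets_spec {A : Ram.Arr} (h0 : A 0 = I.cell) :
    (∀ k, k ≠ 1 → Ram.fillOffsets I.encode.length A k = A k) ∧
      ∀ i ≤ I.rows, Ram.fillOffsets I.encode.length A 1 i = I.offset i := by
  have key := Ram.iter_inv (B := I.encode.length) (A := Ram.setCell A 1 0 3)
    (H := fun i A => Ram.setCell A 1 (i + 1)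
      (A 1 i + (2 + Ram.statesA A i + Ram.mulB I.encode.length (A 0 2) (Ram.statesA A i))))
    (fun t A' => (∀ k, k ≠ 1 → A' k = A k) ∧ ∀ i ≤ t, i ≤ I.rows → A' 1 i = I.offset i) ?_ ?_
  · exact ⟨key.1, fun i hi => key.2 i (hi.trans I.rows_lt_length.le) hi⟩
  · refine ⟨fun k hk => Ram.setCell_of_ne _ _ _ hk, fun i hi _ => ?_⟩
    obtain rfl : i = 0 := by omega
    simp [Ram.setCell, offset]
  · rintro t - A' ⟨h1, h2⟩
    refine ⟨fun k hk => by rw [Ram.setCell_of_ne _ _ _ hk, h1 k hk], fun i hi hir => ?_⟩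
    rw [Ram.setCell_same]
    by_cases e : i = t + 1
    · subst e
      have hs : Ram.statesA A' t = I.states ⟨t, hir⟩ := by
        rw [Ram.statesA, h2 t le_rfl (by omega), h1 0 (by decide), h0]
        exact I.cell_states ⟨t, hir⟩
      rw [Function.update_self, hs, h2 t le_rfl (by omega), h1 0 (by decide), h0, I.cell_two,
        Ram.mulB_eq (I.states_lt_length _).le, I.offset_succ ⟨t, hir⟩, mul_comm I.vals]
    · rw [Function.update_of_ne e]
      exact h2 i (by omega) hir

theorem maxStatesA_eq {A : Ram.Arr} (h0 : A 0 = I.cell) (h1 : ∀ i ≤ I.rows, A 1 i = I.offset i) :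
    Ram.maxStatesA I.encode.length A = I.maxStates := by
  have hs : ∀ i (hi : i < I.rows), Ram.statesA A i = I.states ⟨i, hi⟩ := fun i hi => by
    rw [Ram.statesA, h1 i hi.le, h0]
    exact I.cell_states ⟨i, hi⟩
  have hp : ∀ i < I.encode.length, i < A 0 0 → Ram.statesA A i ≤ I.maxStates := fun i _ hi => by
    rw [h0, I.cell_zero] at hi
    rw [hs i hi]
    exact I.states_le_maxStates _
  refine le_antisymm (Ram.find_le I.maxStates_lt_length hp) (Finset.sup_le fun i _ => ?_)
  have := (Ram.find_spec (p := fun s => ∀ i < I.encode.length, i < A 0 0 → Ram.statesA A i ≤ s)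
    ⟨_, I.maxStates_lt_length, hp⟩).2 i (i.2.trans I.rows_lt_length)
    (by rw [h0, I.cell_zero]; exact i.2)
  rwa [hs i i.2] at this

/-- The powers may exceed the loop bound: `mulB` truncates only its second factor, here the number
of states, which is less than the length of the encoding. -/
theorem fillPowers_spec {A : Ram.Arr} (h0 : A 0 = I.cell)
    (h1 : ∀ i ≤ I.rows, A 1 i = I.offset i) : I.Loaded (Ram.fillPowers I.encode.length A) := by
  have key := Ram.iter_inv (B := I.encode.length) (A := Ram.setCell A 7 0 1)
    (H := fun i A => Ram.setCell A 7 (i + 1)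
      (Ram.mulB I.encode.length (A 7 i) (Ram.maxStatesA I.encode.length A)))
    (fun t A' => (∀ k, k ≠ 7 → A' k = A k) ∧ ∀ i ≤ t, A' 7 i = I.maxStates ^ i) ?_ ?_
  · exact ⟨(key.1 0 (by decide)).trans h0, fun i hi => by
      rw [← h1 i hi]; exact congrFun (key.1 1 (by decide)) i,
      fun i hi => key.2 i (hi.trans I.rows_lt_length.le)⟩
  · refine ⟨fun k hk => Ram.setCell_of_ne _ _ _ hk, fun i hi => ?_⟩
    obtain rfl : i = 0 := by omega
    simp [Ram.setCell]
  · rintro t - A' ⟨k1, k2⟩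
    refine ⟨fun k hk => by rw [Ram.setCell_of_ne _ _ _ hk, k1 k hk], fun i hi => ?_⟩
    rw [Ram.setCell_same]
    by_cases e : i = t + 1
    · subst e
      rw [Function.update_self, k2 t le_rfl, I.maxStatesA_eq ((k1 0 (by decide)).trans h0)
        (fun i hi => by rw [k1 1 (by decide), h1 i hi]), Ram.mulB_eq I.maxStates_lt_length.le, pow_succ]
    · rw [Function.update_of_ne e]
      exact k2 i (by omega)

theorem loopBound_eq {A : Ram.Arr} (h : I.Loaded A) : Ram.loopBound I.encode.length A =
    I.maxStates ^ I.rows * I.encode.length ^ 4 := by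
  simp only [Ram.loopBound, Ram.mulB_eq le_rfl]
  rw [h.cell, I.cell_zero, h.power _ le_rfl]
  ring

/-- Apart from the codes, the largest demand is `P * (P + 1)` for `P = I.vals * I.rows` slots. The
bits of the domains alone occupy at least `P` cells, so `L ^ 2` would do, and `L ^ 4` is ample. -/
theorem fits (hr : 0 < I.rows) (hc : 0 < I.cols) (hv : 0 < I.vals) :
    I.Fits (I.maxStates ^ I.rows * I.encode.length ^ 4) := by
  have hlen := I.length_encode
  have hrows := I.rows_lt_length
  set L := I.encode.length
  have hQ : 1 ≤ I.maxStates ^ I.rows := Nat.one_le_pow _ _ (I.maxStates_pos hr)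
  have hL : 1 ≤ L := by omega
  have h4 : L * L ≤ L ^ 4 := by
    have := Nat.pow_le_pow_right hL (show 2 ≤ 4 by norm_num)
    rwa [sq] at this
  have h1 : L ≤ L * L := Nat.le_mul_of_pos_right _ hL
  have hW : L ^ 4 ≤ I.maxStates ^ I.rows * L ^ 4 := Nat.le_mul_of_pos_left _ hQ
  have hoff : 3 ≤ I.offset I.rows := Nat.le_add_right ..
  have hP : I.vals * I.rows ≤ I.rows * I.cols * I.vals := by
    rw [mul_comm I.vals]
    exact Nat.mul_le_mul_right _ (Nat.le_mul_of_pos_right _ hc)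
  have hPL : I.vals * I.rows + 1 < L := by omega
  have hlt : I.vals * I.rows * (I.vals * I.rows + 1) < L * L :=
    Nat.mul_lt_mul'' (by omega) hPL
  exact ⟨hr, hc, hv, by omega, by omega, by omega,
    Nat.le_mul_of_pos_right _ (by positivity), by omega⟩

/-! ### The running time -/

/-- `Q ^ r = 2 ^ (r log₂ Q)` for positive `Q`. Without rows `I.maxStates` is 0 and this use of the
logarithm is not available, but the power is 1. -/
theorem codes_le_two_pow : I.maxStates ^ I.rows ≤ 2 ^ I.parameter := by
  rcases Nat.eq_zero_or_pos I.rows with h | h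
  · rw [h, pow_zero]
    exact Nat.one_le_two_pow
  have hQ : (0 : ℝ) < I.maxStates := by exact_mod_cast I.maxStates_pos h
  have h1 : (I.maxStates : ℝ) ^ I.rows = 2 ^ ((I.rows : ℝ) * Real.logb 2 I.maxStates) := by
    rw [mul_comm, Real.rpow_mul (by norm_num), Real.rpow_logb (by norm_num) (by norm_num) hQ,
      Real.rpow_natCast]
  have h2 : (2 : ℝ) ^ ((I.rows : ℝ) * Real.logb 2 I.maxStates) ≤ 2 ^ (I.parameter : ℝ) :=
    Real.rpow_le_rpow_of_exponent_le (by norm_num) (Nat.le_ceil _)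
  rw [← h1, Real.rpow_natCast] at h2
  exact_mod_cast h2

end RegularGcc

/-! ### Assembling the program and its running time -/

theorem length_le_inputSize (x : List ℕ) : x.length ≤ inputSize x := by
  induction x with
  | nil => simp
  | cons a x ih =>
    simp only [inputSize, List.map_cons, List.sum_cons, List.length_cons] at ih ⊢
    omega

theorem Polynomial.eval_mono_nat (p : Polynomial ℕ) {a b : ℕ} (h : a ≤ b) :
    p.eval a ≤ p.eval b := by
  rw [Polynomial.eval_eq_sum_range, Polynomial.eval_eq_sum_range]
  gcongr

/-- No monomial has a degree above `p.natDegree`, and `1 ≤ a`. With `a` depending on the parameter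
and `b` on the input size, this gives a bound of fixed-parameter form. -/
theorem Polynomial.eval_mul_le (p : Polynomial ℕ) {a : ℕ} (ha : 1 ≤ a) (b : ℕ) :
    p.eval (a * b) ≤ a ^ p.natDegree * p.eval b := by
  rw [Polynomial.eval_eq_sum_range, Polynomial.eval_eq_sum_range, Finset.mul_sum]
  refine Finset.sum_le_sum fun i hi => ?_
  rw [mul_pow, mul_left_comm]
  refine Nat.mul_le_mul_right _ (Nat.pow_le_pow_right ha ?_)
  rw [Finset.mem_range] at hi
  omega

theorem computable_two_pow_pow (d : ℕ) : Computable fun k => (2 ^ k) ^ d := by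
  have h : Primrec₂ ((· ^ ·) : ℕ → ℕ → ℕ) := Primrec₂.unpaired'.1 Nat.Primrec.pow
  exact (h.comp (h.comp (.const 2) .id) (.const d)).to_comp

namespace RegularGcc

/-- Instances without rows, columns or values escape `Fits`. For them both the domains and the
computed number of output bits are empty, so it does not matter what the main part computes. -/
theorem encodeDomains_eq_filter (I : RegularGcc) {A : Ram.Arr} (h : I.Loaded A) {W : ℕ}
    (hW : W = I.maxStates ^ I.rows * I.encode.length ^ 4) :
    I.encodeDomains I.consistentDomains =
      ((List.range W).filter fun t => t < Ram.sizeA W A).map (Ram.decideAll W A 6) := by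
  by_cases hpos : 0 < I.rows ∧ 0 < I.cols ∧ 0 < I.vals
  · have hfit := I.fits hpos.1 hpos.2.1 hpos.2.2
    rw [← hW] at hfit
    rw [hfit.encodeDomains_eq h, hfit.sizeA_eq h]
    congr 1
    obtain ⟨c, hc⟩ := Nat.exists_eq_add_of_le hfit.size_le
    rw [hc, List.range_add, List.filter_append, List.filter_eq_self.2 fun t ht => by simpa using ht,
      List.filter_eq_nil_iff.2 fun t ht => ?_, List.append_nil]
    obtain ⟨k, -, rfl⟩ := List.mem_map.1 ht
    simp
  · have hz : I.rows = 0 ∨ I.cols = 0 ∨ I.vals = 0 := by omega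
    have e1 : Ram.sizeA W A = 0 := by
      rw [Ram.sizeA, h.cell, I.cell_zero, I.cell_one, I.cell_two, Ram.mulB, Ram.mulB]
      rcases hz with h | h | h <;> simp [h]
    have e2 : (I.encodeDomains I.consistentDomains).length = 0 := by
      rw [I.length_encodeDomains]
      rcases hz with h | h | h <;> simp [h]
    rw [List.length_eq_zero_iff.1 e2, e1, List.filter_eq_nil_iff.2 fun t _ => by simp, List.map_nil]

/-- A program for domain consistency, its running time being polynomial in the length of the
encoding and in the number of loop iterations of the main part. -/
theorem exists_program : ∃ (P : Ram.Prog) (p q : Polynomial ℕ), ∀ I : RegularGcc,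
    Ram.Runs P (Ram.init I.encode)
      (p.eval I.encode.length + q.eval (I.maxStates ^ I.rows * I.encode.length ^ 4))
      fun s => s.out = I.encodeDomains I.consistentDomains := by
  obtain ⟨P1, p1, hP1⟩ := (Ram.compT_fillOffsets (n := 0)).2 0 le_rfl
  obtain ⟨P2, p2, hP2⟩ := (Ram.compT_fillPowers (n := 0)).2 0 le_rfl
  obtain ⟨P3, p3, hP3⟩ := (Ram.comp_loopBound (n := 0)).2 0 le_rfl
  obtain ⟨P4, p4, hP4⟩ := (Ram.comp_sizeA (n := 0)).2 0 le_rfl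
  -- Taking 1 rather than 0 protects register `1`, which holds the number of output bits during the
  -- main part.
  obtain ⟨P5, p5, hP5⟩ := (Ram.compT_decideAll (n := 1)).2 1 le_rfl
  -- Register `0` is the length of the encoding during the preparation; then the computed loop bound
  -- is copied into it from register `1`. Hence the two polynomials.
  refine ⟨.seq Ram.relocate (.seq P1 (.seq P2 (.seq P3 (.seq (.op (.copy 0 1)) (.seq P4
    (.seq P5 Ram.emit)))))), (10 * Polynomial.X + 2) + (p1 + (p2 + (p3 + 1))),
    p4 + (p5 + (13 * Polynomial.X + 2)), fun I => ?_⟩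
  obtain ⟨L, hL⟩ : ∃ L, L = I.encode.length := ⟨_, rfl⟩
  obtain ⟨W, hW⟩ : ∃ W, W = I.maxStates ^ I.rows * L ^ 4 := ⟨_, rfl⟩
  have hrun : Ram.Runs (.seq Ram.relocate (.seq P1 (.seq P2 (.seq P3 (.seq (.op (.copy 0 1))
      (.seq P4 (.seq P5 Ram.emit))))))) (Ram.init I.encode)
      ((10 * L + 2) + (p1.eval L + (p2.eval L + (p3.eval L + (1 + (p4.eval W + (p5.eval W +
        (13 * W + 2)))))))) fun s => s.out = I.encodeDomains I.consistentDomains := by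
    have h0 := Ram.runs_relocate I.encode
    rw [← hL] at h0
    refine .seq (h0.mono le_rfl fun s1 ⟨m1, o1, r1⟩ => .seq ?_)
    have h := hP1 s1 _ m1
    simp only [r1] at h
    refine h.mono le_rfl fun s2 ⟨m2, o2, r2⟩ => .seq ?_
    replace r2 : s2.reg 0 = L := (r2 0 le_rfl).trans r1
    have h := hP2 s2 _ m2
    rw [r2] at h
    refine h.mono le_rfl fun s3 ⟨m3, o3, r3⟩ => .seq ?_
    replace r3 : s3.reg 0 = L := (r3 0 le_rfl).trans r2
    simp only [r2] at m3
    obtain ⟨f1, f2⟩ := I.fillOffsets_spec (A := Ram.inputArr I.encode) I.inputArr_cell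
    rw [← hL] at f1 f2
    have hload := I.fillPowers_spec ((f1 0 (by decide)).trans I.inputArr_cell) f2
    rw [← hL] at hload
    generalize Ram.fillPowers L (Ram.fillOffsets L (Ram.inputArr I.encode)) = A at m3 hload
    have h := hP3 s3 A m3
    rw [r3] at h
    refine h.mono le_rfl fun s4 ⟨m4, o4, r4, v4⟩ => .seq (.op (.seq ?_))
    replace v4 : s4.reg 1 = W := v4.trans (by
      change Ram.loopBound (s3.reg 0) A = W
      rw [r3]
      rw [hL, I.loopBound_eq hload, ← hL, hW])
    set s5 := Ram.Op.apply (.copy 0 1) s4 with hs5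
    have r5 : s5.reg 0 = W := by
      simp [hs5, Ram.Op.apply]
      exact v4
    have m5 : s5.mem = Ram.flat A := m4.trans m3
    have o5 : s5.out = [] := o4.trans (o3.trans (o2.trans o1))
    have h := hP4 s5 A m5
    rw [r5] at h
    refine h.mono le_rfl fun s6 ⟨m6, o6, r6, v6⟩ => .seq ?_
    replace v6 : s6.reg 1 = Ram.sizeA W A := v6.trans (by
      change Ram.sizeA (s5.reg 0) A = _
      rw [r5])
    replace r6 : s6.reg 0 = W := (r6 0 le_rfl).trans r5
    have h := hP5 s6 A (m6.trans m5)
    rw [r6] at h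
    refine h.mono le_rfl fun s7 ⟨m7, o7, r7⟩ => ?_
    have h := Ram.runs_emit m7 (o7.trans (o6.trans o5))
    rw [r7 0 (by omega), r6, r7 1 le_rfl, v6] at h
    refine h.mono le_rfl fun s8 h8 => ?_
    rw [h8]
    change List.map (Ram.decideAll (s6.reg 0) A 6) _ = _
    rw [r6]
    exact (I.encodeDomains_eq_filter hload (hL ▸ hW)).symm
  rw [← hL, ← hW]
  refine hrun.mono (le_of_eq ?_) fun _ h => h
  simp only [Polynomial.eval_add, Polynomial.eval_mul, Polynomial.eval_X, Polynomial.eval_ofNat,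
    Polynomial.eval_one]
  ring

end RegularGcc

/-- Enforcing domain consistency on RegularGcc is fixed-parameter tractable in `r * log Q`. -/
theorem theorem6 :
    FixedParameterTractable RegularGcc.encode
      (fun I y => ∃ D : I.Domains, I.EnforcesDC D ∧ y = I.encodeDomains D)
      RegularGcc.parameter := by
  obtain ⟨P, p, q, h⟩ := RegularGcc.exists_program
  -- The factor depending on `k` is what `Polynomial.eval_mul_le` extracts from `q` at `2 ^ k * S ^
  -- 4`, where `S` is the input size. It is at least 1, so it may multiply `p` as well.
  refine ⟨P, fun k => (2 ^ k) ^ q.natDegree, p + q.comp (Polynomial.X ^ 4),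
    computable_two_pow_pow _, fun I => ?_⟩
  obtain ⟨t, s, he, ht, hs⟩ := h I
  refine ⟨t, _, ⟨s, he, rfl⟩, ⟨_, I.enforcesDC_consistentDomains, hs⟩, ht.trans ?_⟩
  have hLS := length_le_inputSize I.encode
  have hq : q.eval (I.maxStates ^ I.rows * I.encode.length ^ 4) ≤
      (2 ^ I.parameter) ^ q.natDegree * q.eval (inputSize I.encode ^ 4) :=
    (q.eval_mono_nat (Nat.mul_le_mul I.codes_le_two_pow (Nat.pow_le_pow_left hLS 4))).trans
      (q.eval_mul_le Nat.one_le_two_pow _)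
  have hp : p.eval I.encode.length ≤
      (2 ^ I.parameter) ^ q.natDegree * p.eval (inputSize I.encode) :=
    (p.eval_mono_nat hLS).trans
      (Nat.le_mul_of_pos_left _ (Nat.pow_pos (Nat.pow_pos Nat.two_pos)))
  rw [Polynomial.eval_add, Polynomial.eval_comp, Polynomial.eval_pow, Polynomial.eval_X, mul_add]
  exact add_le_add hp hq
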